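/- **Horoball counting.** Let $(X,d)$ be a proper, uniquely geodesic metric space which is Gromov hyperbolic and such that, for all $x,y\in X$, the function $z\mapsto d(x,z)-d(y,z)$ extends continuously to the hyperbolic boundary $\partial X$; for $\xi\in\partial X$ write $\beta_\xi(x,y)=\lim_{z\to\xi}(d(x,z)-d(y,z))$ for the Busemann function. Let $\Gamma$ be a discrete group of isometries of $X$, with limit set $\Lambda_\Gamma\subseteq\partial X$. A point $p\in\Lambda_\Gamma$ is parabolic if its stabilizer in $\Gamma$ is infinite and contains no loxodromic isometry; let $P$ be the set of parabolic points. Assume that $\Gamma$ is geometrically finite, i.e. every point of $\Lambda_\Gamma$ is either a conical limit point or a bounded parabolic point (a parabolic point whose stabilizer acts cocompactly on the complement of that point in $\Lambda_\Gamma$), and that $P\neq\emptyset$. Fix a base point $o\in X$ and a $\Gamma$-invariant horoball packing: pairwise disjoint horoballs $(H_p)_{p\in P}$ with $gH_p=H_{gp}$ for $g\in\Gamma$, where $H_p$ is a sublevel set of $x\mapsto\beta_p(x,o)$. Let $r_p=e^{-d(o,H_p)}$ be the radius of $H_p$, where $d(o,H_p)$ is the signed distance (equal to $-d(o,X\setminus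 H_p)$ if $o\in H_p$). For $p\in P$ let $\delta_p$ be the critical exponent of the stabilizer $\mathrm{Stab}_\Gamma(p)$, i.e. $\delta_p=\limsup_{t\to\infty}\frac1t\log\#\{g\in\mathrm{Stab}_\Gamma(p): d(o,go)\le t\}$. Let $\delta>0$ with $\delta>\delta_p$ for all $p\in P$, and let $(\mu_x)_{x\in X}$ be a $\delta$-conformal density for $\Gamma$ on $\Lambda_\Gamma$: finite Borel measures on $\partial X$ giving full mass to $\Lambda_\Gamma$, with $g_*\mu_x=\mu_{gx}$ for $g\in\Gamma$ and $\frac{d\mu_x}{d\mu_y}(\eta)=e^{-\delta\beta_\eta(x,y)}$. Assume that $\mu_o$ satisfies the global shadow lemma: there is $C\ge1$ such that for all $\xi\in\Lambda_\Gamma$ and $t\ge0$ $$C^{-1}e^{-\delta t+(2k-\delta)\,d(\xi_t,\Gamma o)}\le\mu_o(V(o,\xi,t))\le C\,e^{-\delta t+(2k-\delta)\,d(\xi_t,\Gamma o)},$$ where $\xi_t$ is the point at distance $t$ from $o$ on the geodesic ray from $o$ to $\xi$, $V(o,\xi,t)$ is the set of $\eta\in\partial X$ whose closest point projection to this ray is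 at distance more than $t$ from $o$, and $k=\delta_p$ if $\xi_t\in H_p$ for some $p\in P$, and $k=0$ if $\xi_t$ lies in no $H_p$. Then there exist $\lambda\in(0,1)$ and a constant $C'>0$ such that for every $n\in\mathbb N=\{0,1,2,\dots\}$ the set $H_n(\lambda)=\{p\in P:\lambda^{n+1}\le r_p\le\lambda^n\}$ is finite and $$\frac1{C'}\,\lambda^{-n\delta}\le\#H_n(\lambda)\le C'\,\lambda^{-n\delta}.$$ -/

import Mathlib

open Filter Topology MeasureTheory
open scoped NNReal

noncomputable section

namespace GromovHyp

/-- The Gromov product of `x` and `y` with respect to `o`. -/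
def gromovProduct {X : Type*} [MetricSpace X] (o x y : X) : ℝ :=
  (dist x o + dist y o - dist x y) / 2

/-- A geodesic ray: an isometric embedding of the half-line `[0, ∞)`. The topology is that of
pointwise convergence, which for geodesic rays is uniform convergence on bounded intervals. -/
abbrev GeodesicRay (X : Type*) [MetricSpace X] : Type _ := {γ : ℝ≥0 → X // Isometry γ}

/-- Two geodesic rays are identified when they stay within bounded distance of each other. -/
instance asymptoticSetoid (X : Type*) [MetricSpace X] : Setoid (GeodesicRay X) where
  r γ γ' := ∃ C : ℝ, ∀ t, dist (γ.1 t) (γ'.1 t) ≤ C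
  iseqv :=
    { refl := fun _ => ⟨0, fun _ => by simp⟩
      symm := fun ⟨C, h⟩ => ⟨C, fun t => by rw [dist_comm]; exact h t⟩
      trans := fun ⟨C, h⟩ ⟨D, k⟩ =>
        ⟨C + D, fun t => (dist_triangle _ _ _).trans (add_le_add (h t) (k t))⟩ }

/-- The hyperbolic boundary `∂X`. -/
def Boundary (X : Type*) [MetricSpace X] : Type _ := Quotient (asymptoticSetoid X)

/-- The endpoint at infinity of a geodesic ray. -/
def endpoint {X : Type*} [MetricSpace X] (γ : GeodesicRay X) : Boundary X :=
  Quotient.mk (asymptoticSetoid X) γ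

/-- The quotient topology from the space of geodesic rays. -/
instance (X : Type*) [MetricSpace X] : TopologicalSpace (Boundary X) :=
  inferInstanceAs (TopologicalSpace (Quotient (asymptoticSetoid X)))

instance (X : Type*) [MetricSpace X] : MeasurableSpace (Boundary X) := borel _

instance (X : Type*) [MetricSpace X] : BorelSpace (Boundary X) := ⟨rfl⟩

/-- The neighbourhoods in `X` of the endpoint of `γ`: the points `z` whose Gromov product with
`γ t`, based at `γ 0`, eventually becomes at least `R`, for `R` arbitrarily large (this Gromov
product is non-decreasing in `t`). -/
def rayFilter {X : Type*} [MetricSpace X] (γ : GeodesicRay X) : Filter X :=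
  ⨅ R : ℝ, 𝓟 {z | ∃ t, R ≤ gromovProduct (γ.1 0) z (γ.1 t)}

theorem rayFilter_le {X : Type*} [MetricSpace X] {γ γ' : GeodesicRay X}
    (h : ∃ C : ℝ, ∀ t, dist (γ.1 t) (γ'.1 t) ≤ C) : rayFilter γ ≤ rayFilter γ' := by
  obtain ⟨C, hC⟩ := h
  refine le_iInf fun R => (iInf_le _ (R + 2 * C)).trans ?_
  rw [principal_mono]
  rintro z ⟨t, ht⟩
  refine ⟨t, ?_⟩
  have h0 := hC 0
  have h1 := hC t
  have a := dist_triangle_right z (γ.1 0) (γ'.1 0)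
  have b := dist_triangle4 (γ.1 t) (γ'.1 t) (γ'.1 0) (γ.1 0)
  have c := dist_triangle z (γ.1 t) (γ'.1 t)
  have d := dist_triangle z (γ'.1 0) (γ.1 0)
  rw [dist_comm (γ'.1 0) (γ.1 0)] at b d
  simp only [gromovProduct] at ht ⊢
  linarith

/-- The filter `z → ξ` on `X`, for a boundary point `ξ`. -/
def toBoundary {X : Type*} [MetricSpace X] (ξ : Boundary X) : Filter X :=
  Quotient.lift rayFilter
    (fun _ _ h => le_antisymm (rayFilter_le h) (rayFilter_le (Setoid.symm h))) ξ

/-- The Busemann function `β_ξ(x, y) = lim_{z → ξ} (d(x, z) - d(y, z))`. -/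
def busemann {X : Type*} [MetricSpace X] (ξ : Boundary X) (x y : X) : ℝ :=
  limUnder (toBoundary ξ) fun z => dist x z - dist y z

/-- Together with `[ProperSpace X]`: `X` is a Busemann regular hyperbolic metric space. -/
structure IsBusemannRegularHyperbolic (X : Type*) [MetricSpace X] : Prop where
  /-- Between any two points there is exactly one geodesic segment. -/
  uniquelyGeodesic : ∀ x y : X, ∃! γ : Set.Icc (0 : ℝ) (dist x y) → X,
    Isometry γ ∧ γ ⟨0, le_rfl, dist_nonneg⟩ = x ∧ γ ⟨dist x y, dist_nonneg, le_rfl⟩ = y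
  /-- The four-point condition of Gromov. -/
  hyperbolic : ∃ α : ℝ, 0 < α ∧ ∀ o x y z : X,
    min (gromovProduct o x z) (gromovProduct o z y) - α ≤ gromovProduct o x y
  /-- For fixed `x, y`, the function `z ↦ d(x, z) - d(y, z)` extends continuously to `∂X`. -/
  busemann_extends : ∀ (ξ : Boundary X) (x y : X),
    ∃ L : ℝ, Tendsto (fun z => dist x z - dist y z) (toBoundary ξ) (𝓝 L)

/-- The action of an isometry on geodesic rays. -/
def mapRay {X : Type*} [MetricSpace X] (g : X ≃ᵢ X) (γ : GeodesicRay X) : GeodesicRay X :=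
  ⟨fun t => g (γ.1 t), g.isometry.comp γ.2⟩

/-- The action of the isometries of `X` on `∂X`. -/
instance (X : Type*) [MetricSpace X] : MulAction (X ≃ᵢ X) (Boundary X) where
  smul g := Quotient.map (mapRay g)
    (fun _ _ ⟨C, h⟩ => ⟨C, fun t => by simpa [mapRay, g.isometry.dist_eq] using h t⟩)
  one_smul ξ := by
    induction ξ using Quotient.inductionOn with
    | h γ => rfl
  mul_smul g h ξ := by
    induction ξ using Quotient.inductionOn with
    | h γ => rfl

/-- `Γ` is discrete, i.e. acts properly discontinuously on the (proper) space `X`. -/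
def IsDiscrete {X : Type*} [MetricSpace X] (Γ : Subgroup (X ≃ᵢ X)) : Prop :=
  ∀ (x : X) (R : ℝ), {g : X ≃ᵢ X | g ∈ Γ ∧ dist x (g x) ≤ R}.Finite

/-- The orbit `Γ x`. -/
def orbit {X : Type*} [MetricSpace X] (Γ : Subgroup (X ≃ᵢ X)) (x : X) : Set X :=
  {y | ∃ g ∈ Γ, g x = y}

/-- The limit set `Λ_Γ`: the accumulation points in `∂X` of the orbits of `Γ`. -/
def limitSet {X : Type*} [MetricSpace X] (Γ : Subgroup (X ≃ᵢ X)) : Set (Boundary X) :=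
  {ξ | ∃ (x : X) (u : ℕ → X), (∀ n, u n ∈ orbit Γ x) ∧ Tendsto u atTop (toBoundary ξ)}

/-- `ξ` is a conical limit point: some sequence in an orbit converges to `ξ` while staying within
bounded distance of a geodesic ray to `ξ`. -/
def IsConical {X : Type*} [MetricSpace X] (Γ : Subgroup (X ≃ᵢ X)) (ξ : Boundary X) : Prop :=
  ∃ (x : X) (u : ℕ → X) (γ : GeodesicRay X) (C : ℝ), endpoint γ = ξ ∧
    (∀ n, u n ∈ orbit Γ x) ∧ Tendsto u atTop (toBoundary ξ) ∧ ∀ n, ∃ t, dist (u n) (γ.1 t) ≤ C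

/-- The stabilizer of `ξ` in `Γ`. -/
def stab {X : Type*} [MetricSpace X] (Γ : Subgroup (X ≃ᵢ X)) (ξ : Boundary X) :
    Subgroup (X ≃ᵢ X) :=
  Γ ⊓ MulAction.stabilizer (X ≃ᵢ X) ξ

/-- `g` is loxodromic: its powers translate points at a positive linear rate. -/
def IsLoxodromic {X : Type*} [MetricSpace X] (g : X ≃ᵢ X) : Prop :=
  ∃ (x : X) (c : ℝ), 0 < c ∧ ∀ n : ℕ, c * n ≤ dist x ((g ^ n) x)

/-- The set `P` of parabolic points: the limit points whose stabilizer in `Γ` is a parabolic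
subgroup, i.e. is infinite and contains no loxodromic isometry. -/
def parabolicPoints {X : Type*} [MetricSpace X] (Γ : Subgroup (X ≃ᵢ X)) : Set (Boundary X) :=
  {p | p ∈ limitSet Γ ∧ (stab Γ p : Set (X ≃ᵢ X)).Infinite ∧ ∀ g ∈ stab Γ p, ¬ IsLoxodromic g}

/-- `p` is a bounded parabolic point: its stabilizer acts cocompactly on `Λ_Γ ∖ {p}`. -/
def IsBoundedParabolic {X : Type*} [MetricSpace X] (Γ : Subgroup (X ≃ᵢ X)) (p : Boundary X) :
    Prop :=
  p ∈ parabolicPoints Γ ∧ ∃ K : Set (Boundary X), IsCompact K ∧ K ⊆ limitSet Γ \ {p} ∧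
    ∀ ξ ∈ limitSet Γ \ {p}, ∃ g ∈ stab Γ p, ∃ η ∈ K, g • η = ξ

/-- `Γ` is a geometrically finite (discrete) group of isometries. -/
structure IsGeometricallyFinite {X : Type*} [MetricSpace X] (Γ : Subgroup (X ≃ᵢ X)) : Prop where
  discrete : IsDiscrete Γ
  conical_or_bounded : ∀ ξ ∈ limitSet Γ, IsConical Γ ξ ∨ IsBoundedParabolic Γ ξ

/-- `H` is a horoball centered at `p`: a sublevel set of the Busemann function at `p`. -/
def IsHoroball {X : Type*} [MetricSpace X] (p : Boundary X) (H : Set X) : Prop :=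
  ∃ (x : X) (c : ℝ), H = {y | busemann p y x < c}

/-- A `Γ`-invariant horoball packing: pairwise disjoint horoballs `H p` centered at the
parabolic points `p`, permuted by `Γ`. Values of `H` at other boundary points are irrelevant. -/
structure IsHoroballPacking {X : Type*} [MetricSpace X] (Γ : Subgroup (X ≃ᵢ X))
    (H : Boundary X → Set X) : Prop where
  isHoroball : ∀ p ∈ parabolicPoints Γ, IsHoroball p (H p)
  equivariant : ∀ g ∈ Γ, ∀ p ∈ parabolicPoints Γ, H (g • p) = g '' H p
  disjoint : ∀ p ∈ parabolicPoints Γ, ∀ q ∈ parabolicPoints Γ, p ≠ q → Disjoint (H p) (H q)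

/-- The radius `e^{-d(o, H)}`, where `d(o, H)` is the signed distance: `d(o, H)` if `o ∉ H` and
`-d(o, X ∖ H)` if `o ∈ H`. -/
def radius {X : Type*} [MetricSpace X] (o : X) (H : Set X) : ℝ :=
  Real.exp (-(Metric.infDist o H - Metric.infDist o Hᶜ))

/-- The set of parabolic points `p` with `l ^ (n + 1) ≤ r_p ≤ l ^ n`. -/
def horoballBand {X : Type*} [MetricSpace X] (Γ : Subgroup (X ≃ᵢ X)) (o : X)
    (H : Boundary X → Set X) (l : ℝ) (n : ℕ) : Set (Boundary X) :=
  {p | p ∈ parabolicPoints Γ ∧ l ^ (n + 1) ≤ radius o (H p) ∧ radius o (H p) ≤ l ^ n}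

/-- The critical exponent `limsup_{t → ∞} (1/t) log #{g ∈ Π : d(o, g o) ≤ t}`. -/
def criticalExponent {X : Type*} [MetricSpace X] (G : Subgroup (X ≃ᵢ X)) (o : X) : EReal :=
  limsup (fun t : ℝ =>
    ((Real.log ({g : X ≃ᵢ X | g ∈ G ∧ dist o (g o) ≤ t}.ncard) / t : ℝ) : EReal)) atTop

/-- A conformal density of dimension `δ` carried by the limit set. -/
structure IsConformalDensity {X : Type*} [MetricSpace X] (Γ : Subgroup (X ≃ᵢ X)) (δ : ℝ)
    (μ : X → Measure (Boundary X)) : Prop where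
  dim_pos : 0 < δ
  finite : ∀ x, IsFiniteMeasure (μ x)
  support : ∀ x, μ x (limitSet Γ)ᶜ = 0
  invariant : ∀ g ∈ Γ, ∀ x, (μ x).map (fun ξ => g • ξ) = μ (g x)
  conformal : ∀ x y,
    μ x = (μ y).withDensity fun η => ENNReal.ofReal (Real.exp (-δ * busemann η x y))

/-- `γ s` is a projection of the boundary point `η` to the geodesic ray `γ`: it minimizes
`β_η(·, γ 0)` over the ray. -/
def IsProjection {X : Type*} [MetricSpace X] (γ : GeodesicRay X) (η : Boundary X) (s : ℝ≥0) :
    Prop :=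
  ∀ u, busemann η (γ.1 s) (γ.1 0) ≤ busemann η (γ.1 u) (γ.1 0)

/-- The shadow `V(o, ξ, t)`, where `γ` is the geodesic ray from `o = γ 0` to `ξ`: the boundary
points `η` whose projection to `γ` is at distance more than `t` from `o`. It contains `ξ`,
as `β_ξ(γ s, o) = -s` has no minimum on the ray. -/
def shadow {X : Type*} [MetricSpace X] (γ : GeodesicRay X) (t : ℝ≥0) : Set (Boundary X) :=
  {η | ∀ s, IsProjection γ η s → t < s}

/-- The two-sided estimate `C⁻¹ A ≤ ν (V(o, ξ, t)) ≤ C A` with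
`A = exp (-δ t + (2 k - δ) d(ξ_t, Γ o))`, where `γ` is the geodesic ray from `o` to `ξ`. -/
def ShadowEstimate {X : Type*} [MetricSpace X] (Γ : Subgroup (X ≃ᵢ X)) (o : X) (δ : ℝ)
    (ν : Measure (Boundary X)) (C : ℝ) (γ : GeodesicRay X) (t : ℝ≥0) (k : ℝ) : Prop :=
  C⁻¹ * Real.exp (-δ * t + (2 * k - δ) * Metric.infDist (γ.1 t) (orbit Γ o)) ≤
      ν.real (shadow γ t) ∧
    ν.real (shadow γ t) ≤
      C * Real.exp (-δ * t + (2 * k - δ) * Metric.infDist (γ.1 t) (orbit Γ o))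

/-- The measure `ν` on `∂X` satisfies the global shadow lemma with respect to the basepoint `o`:
the shadow estimate holds with uniform constants for all `ξ ∈ Λ_Γ` and `t ≥ 0`, with exponent
`k = δ_Π`, `Π` being the stabilizer of `p`, if `ξ_t` lies in the horoball `H p`, and with `k = 0`
if `ξ_t` lies in no horoball of the packing. -/
def GlobalShadowLemma {X : Type*} [MetricSpace X] (Γ : Subgroup (X ≃ᵢ X)) (o : X)
    (H : Boundary X → Set X) (δ : ℝ) (ν : Measure (Boundary X)) : Prop :=
  ∃ C : ℝ, 0 < C ∧ ∀ γ : GeodesicRay X, γ.1 0 = o → endpoint γ ∈ limitSet Γ → ∀ t : ℝ≥0,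
    (∀ p ∈ parabolicPoints Γ, γ.1 t ∈ H p →
      ShadowEstimate Γ o δ ν C γ t (criticalExponent (stab Γ p) o).toReal) ∧
    ((∀ p ∈ parabolicPoints Γ, γ.1 t ∉ H p) → ShadowEstimate Γ o δ ν C γ t 0)

end GromovHyp

end

open GromovHyp

/-! Write τ_p for the distance from `o` to H_p (taken to be 0 if `o` lies in H_p) and k_p for the
critical exponent of the stabilizer of p. Geometric finiteness gives the one geometric input: along
a ray from `o` to a limit point, the distance to the orbit is bounded except inside horoballs, where
it is at most the depth up to a constant (`exists_infDist_le`). Hence on the ray to p the distance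
to the orbit at time u ≥ τ_p is u − τ_p + O(1), and the shadow lemma gives the shadow of p at time u
> τ_p a mass comparable to exp(−δ τ_p − 2(δ − k_p)(u − τ_p)) (`exists_shadow_bounds`).

Upper bound. Just inside their horoballs, rays to distinct parabolic points with τ_p in [j, j + 1]
are uniformly apart, because the horoballs are disjoint. The corresponding tubes are disjoint and
each has mass at least a constant times e^{−δj}, so the finite total mass allows O(e^{δj}) of them
(`exists_card_layer_le`).

Lower bound. A limit point whose ray is at time N at depth s in H_p lies in the shadow of p at a
time close to (N + τ_p + s)/2, of mass O(exp(−δ τ_p − (δ − k_p)(N − τ_p + s))). There are finitely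
many `Γ`-orbits of parabolic points, so k_p ≤ κ < δ uniformly. The upper bound on the layers cancels
e^{−δ τ_p}, and a geometric series remains which is small for large s, uniformly in N. So at every
time N at least half of the mass sits on limit points whose ray is within bounded distance of the
orbit (`exists_le_recurrentSet`). Close to such a ray point there is a translate of one of two fixed
horoballs, hence a p with τ_p = N + O(1) whose shadow at time N − O(1) contains the limit point.
Each such shadow has mass O(e^{−δN}), so at least a constant times e^{δN} of them are needed
(`exists_le_ncard`).

Finally λ = e^{−L}, with L so large that every band contains one of the windows of the lower bound.
-/

noncomputable section

namespace GromovHyp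

/-! ### Busemann functions and Gromov products up to the boundary -/

variable {X : Type*} [MetricSpace X]

/-- The four-point inequality with constant `α`. -/
def FourPoint (X : Type*) [MetricSpace X] (α : ℝ) : Prop :=
  0 < α ∧ ∀ o x y z : X,
    min (gromovProduct o x z) (gromovProduct o z y) - α ≤ gromovProduct o x y

theorem gromovProduct_comm (o x y : X) : gromovProduct o x y = gromovProduct o y x := by
  simp only [gromovProduct, dist_comm x y]; ring

theorem gromovProduct_add_swap (o x y : X) :
    gromovProduct o x y + gromovProduct x o y = dist x o := by
  simp only [gromovProduct, dist_comm o x, dist_comm x y, dist_comm o y]; ring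

theorem dist_ray (γ : GeodesicRay X) (s t : ℝ≥0) :
    dist (γ.1 s) (γ.1 t) = |(s : ℝ) - t| := by
  rw [γ.2.dist_eq, NNReal.dist_eq]

theorem dist_ray_zero (γ : GeodesicRay X) (t : ℝ≥0) : dist (γ.1 t) (γ.1 0) = t := by
  simp [dist_ray]

theorem gromovProduct_ray (γ : GeodesicRay X) {s t : ℝ≥0} (h : s ≤ t) :
    gromovProduct (γ.1 0) (γ.1 s) (γ.1 t) = s := by
  have h' : (s : ℝ) ≤ t := h
  rw [gromovProduct, dist_ray_zero, dist_ray_zero, dist_ray, abs_of_nonpos (by linarith)]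
  ring

theorem gromovProduct_ray_mono (γ : GeodesicRay X) (z : X) :
    Monotone fun t => gromovProduct (γ.1 0) z (γ.1 t) := by
  intro s t h
  have h' : (s : ℝ) ≤ t := h
  have h1 := dist_triangle z (γ.1 s) (γ.1 t)
  rw [dist_ray, abs_of_nonpos (by linarith)] at h1
  simp only [gromovProduct, dist_ray_zero]
  linarith

theorem mem_rayFilter {γ : GeodesicRay X} {s : Set X} :
    s ∈ rayFilter γ ↔ ∃ R : ℝ, {z | ∃ t, R ≤ gromovProduct (γ.1 0) z (γ.1 t)} ⊆ s := by
  rw [rayFilter, mem_iInf_of_directed]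
  · simp
  · intro a b
    exact ⟨max a b, principal_mono.2 fun z ⟨t, ht⟩ => ⟨t, (le_max_left _ _).trans ht⟩,
      principal_mono.2 fun z ⟨t, ht⟩ => ⟨t, (le_max_right _ _).trans ht⟩⟩

theorem toBoundary_endpoint (γ : GeodesicRay X) : toBoundary (endpoint γ) = rayFilter γ := rfl

theorem exists_endpoint_eq (ξ : Boundary X) : ∃ γ : GeodesicRay X, endpoint γ = ξ :=
  Quotient.exists_rep ξ

theorem tendsto_ray (γ : GeodesicRay X) : Tendsto γ.1 atTop (toBoundary (endpoint γ)) := by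
  rw [toBoundary_endpoint]
  intro s hs
  obtain ⟨R, hR⟩ := mem_rayFilter.1 hs
  rw [mem_map]
  filter_upwards [eventually_ge_atTop R.toNNReal] with t ht
  refine hR ⟨t, ?_⟩
  rw [gromovProduct_ray γ le_rfl]
  exact (Real.le_coe_toNNReal R).trans ht

instance toBoundary_neBot (ξ : Boundary X) : (toBoundary ξ).NeBot := by
  obtain ⟨γ, rfl⟩ := exists_endpoint_eq ξ
  exact (tendsto_ray γ).neBot

theorem tendsto_busemann (hX : IsBusemannRegularHyperbolic X) (ξ : Boundary X) (x y : X) :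
    Tendsto (fun z => dist x z - dist y z) (toBoundary ξ) (𝓝 (busemann ξ x y)) :=
  tendsto_nhds_limUnder (hX.busemann_extends ξ x y)

theorem busemann_self (hX : IsBusemannRegularHyperbolic X) (ξ : Boundary X) (x : X) :
    busemann ξ x x = 0 :=
  tendsto_nhds_unique (tendsto_busemann hX ξ x x) (by simp)

theorem busemann_add (hX : IsBusemannRegularHyperbolic X) (ξ : Boundary X) (x y z : X) :
    busemann ξ x y + busemann ξ y z = busemann ξ x z :=
  tendsto_nhds_unique ((tendsto_busemann hX ξ x y).add (tendsto_busemann hX ξ y z))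
    (by simpa using tendsto_busemann hX ξ x z)

theorem busemann_swap (hX : IsBusemannRegularHyperbolic X) (ξ : Boundary X) (x y : X) :
    busemann ξ x y = -busemann ξ y x := by
  have := busemann_add hX ξ x y x
  rw [busemann_self hX] at this
  linarith

theorem busemann_le_dist (hX : IsBusemannRegularHyperbolic X) (ξ : Boundary X) (x y : X) :
    busemann ξ x y ≤ dist x y :=
  le_of_tendsto (tendsto_busemann hX ξ x y) (Eventually.of_forall fun z => by
    have := dist_triangle x y z
    linarith)

theorem neg_dist_le_busemann (hX : IsBusemannRegularHyperbolic X) (ξ : Boundary X) (x y : X) :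
    -dist x y ≤ busemann ξ x y := by
  rw [busemann_swap hX, dist_comm]
  exact neg_le_neg (busemann_le_dist hX ξ y x)

theorem busemann_ray (hX : IsBusemannRegularHyperbolic X) (γ : GeodesicRay X) (s t : ℝ≥0) :
    busemann (endpoint γ) (γ.1 s) (γ.1 t) = t - s := by
  refine tendsto_nhds_unique ((tendsto_busemann hX _ _ _).comp (tendsto_ray γ)) ?_
  refine tendsto_const_nhds.congr' ?_
  filter_upwards [eventually_ge_atTop (max s t)] with u hu
  have h1 : (s : ℝ) ≤ u := (le_max_left s t).trans hu
  have h2 : (t : ℝ) ≤ u := (le_max_right s t).trans hu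
  simp only [Function.comp, dist_ray]
  rw [abs_of_nonpos (by linarith), abs_of_nonpos (by linarith)]
  ring

/-- The Gromov product `(x | ξ)_o` of a point `x` and a boundary point `ξ`. -/
def boundaryProduct (o x : X) (ξ : Boundary X) : ℝ :=
  (dist x o - busemann ξ x o) / 2

theorem tendsto_gromovProduct (hX : IsBusemannRegularHyperbolic X) (o x : X) (ξ : Boundary X) :
    Tendsto (fun z => gromovProduct o x z) (toBoundary ξ) (𝓝 (boundaryProduct o x ξ)) := by
  refine (((tendsto_busemann hX ξ x o).const_sub (dist x o)).div_const 2).congr fun z => ?_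
  simp only [gromovProduct, dist_comm z o]; ring

theorem boundaryProduct_nonneg (hX : IsBusemannRegularHyperbolic X) (o x : X) (ξ : Boundary X) :
    0 ≤ boundaryProduct o x ξ := by
  have := busemann_le_dist hX ξ x o
  rw [boundaryProduct]; linarith

theorem boundaryProduct_le_dist (hX : IsBusemannRegularHyperbolic X) (o x : X)
    (ξ : Boundary X) : boundaryProduct o x ξ ≤ dist x o := by
  have := neg_dist_le_busemann hX ξ x o
  rw [boundaryProduct]; linarith

theorem boundaryProduct_add_swap (hX : IsBusemannRegularHyperbolic X) (o x : X)
    (ξ : Boundary X) : boundaryProduct o x ξ + boundaryProduct x o ξ = dist x o := by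
  rw [boundaryProduct, boundaryProduct, busemann_swap hX ξ o x, dist_comm o x]; ring

theorem boundaryProduct_basepoint (hX : IsBusemannRegularHyperbolic X) (o o' x : X)
    (ξ : Boundary X) : boundaryProduct o x ξ ≤ boundaryProduct o' x ξ + dist o o' := by
  have h1 := dist_triangle_right x o o'
  have h2 := busemann_add hX ξ x o o'
  have h3 := busemann_le_dist hX ξ o o'
  have h4 := dist_triangle x o' o
  rw [dist_comm o' o] at h4
  rw [boundaryProduct, boundaryProduct]; linarith

theorem boundaryProduct_le_add_dist (hX : IsBusemannRegularHyperbolic X) (o x y : X)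
    (ξ : Boundary X) : boundaryProduct o x ξ ≤ boundaryProduct o y ξ + dist x y := by
  have h1 := dist_triangle x y o
  have h2 := busemann_add hX ξ x y o
  have h3 := neg_dist_le_busemann hX ξ x y
  rw [boundaryProduct, boundaryProduct]; linarith

theorem boundaryProduct_ray (hX : IsBusemannRegularHyperbolic X) (γ : GeodesicRay X) (t : ℝ≥0) :
    boundaryProduct (γ.1 0) (γ.1 t) (endpoint γ) = t := by
  rw [boundaryProduct, dist_ray_zero, busemann_ray hX]; simp

/-- Busemann regularity makes `boundaryProduct` a genuine limit of Gromov products, so the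
four-point inequality passes to a boundary point with the same constant α. -/
theorem FourPoint.boundaryProduct_ge {α : ℝ} (hα : FourPoint X α)
    (hX : IsBusemannRegularHyperbolic X) (o x y : X) (ξ : Boundary X) :
    min (gromovProduct o x y) (boundaryProduct o y ξ) - α ≤ boundaryProduct o x ξ :=
  le_of_tendsto_of_tendsto' ((tendsto_const_nhds.min (tendsto_gromovProduct hX o y ξ)).sub_const α)
    (tendsto_gromovProduct hX o x ξ) fun z => hα.2 o x z y

theorem FourPoint.gromovProduct_ge {α : ℝ} (hα : FourPoint X α)
    (hX : IsBusemannRegularHyperbolic X) (o x y : X) (ξ : Boundary X) :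
    min (boundaryProduct o x ξ) (boundaryProduct o y ξ) - α ≤ gromovProduct o x y :=
  le_of_tendsto (((tendsto_gromovProduct hX o x ξ).min
    (tendsto_gromovProduct hX o y ξ)).sub_const α) (Eventually.of_forall fun z => by
      rw [gromovProduct_comm o y z]
      exact hα.2 o x y z)

/-- The four-point inequality with one point at infinity. -/
theorem FourPoint.dist_add_busemann_le {α : ℝ} (hα : FourPoint X α)
    (hX : IsBusemannRegularHyperbolic X) (o x y w : X) (ξ : Boundary X) :
    dist x y + busemann ξ w o ≤
      max (dist x w + busemann ξ y o) (dist y w + busemann ξ x o) + 2 * α := by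
  have h := hα.gromovProduct_ge hX w x y ξ
  have hx := busemann_add hX ξ x w o
  have hy := busemann_add hX ξ y w o
  simp only [boundaryProduct, gromovProduct] at h
  rcases min_le_iff.1 (sub_le_iff_le_add.1 h) with h | h
  · have := le_max_right (dist x w + busemann ξ y o) (dist y w + busemann ξ x o)
    linarith
  · have := le_max_left (dist x w + busemann ξ y o) (dist y w + busemann ξ x o)
    linarith

/-- The products with γ t increase to the product with the endpoint, so `rayFilter` is generated by
superlevel sets of `boundaryProduct`. A change of basepoint costs only a bounded error. -/
theorem tendsto_toBoundary_iff (hX : IsBusemannRegularHyperbolic X) (o : X) {ξ : Boundary X}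
    {ι : Type*} {F : Filter ι} {u : ι → X} :
    Tendsto u F (toBoundary ξ) ↔ Tendsto (fun i => boundaryProduct o (u i) ξ) F atTop := by
  obtain ⟨γ, rfl⟩ := exists_endpoint_eq ξ
  rw [toBoundary_endpoint, tendsto_atTop]
  constructor
  · intro h R
    filter_upwards [h (mem_rayFilter.2 ⟨R + dist o (γ.1 0), subset_rfl⟩)] with i hi
    obtain ⟨t, ht⟩ := hi
    have h1 : gromovProduct (γ.1 0) (u i) (γ.1 t) ≤
        boundaryProduct (γ.1 0) (u i) (endpoint γ) :=
      (gromovProduct_ray_mono γ (u i)).ge_of_tendsto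
        ((tendsto_gromovProduct hX (γ.1 0) (u i) _).comp (tendsto_ray γ)) t
    have h2 := boundaryProduct_basepoint hX (γ.1 0) o (u i) (endpoint γ)
    rw [dist_comm] at h2
    linarith
  · intro h s hs
    obtain ⟨R, hR⟩ := mem_rayFilter.1 hs
    rw [mem_map]
    filter_upwards [h (R + dist o (γ.1 0) + 1)] with i hi
    have h2 := boundaryProduct_basepoint hX o (γ.1 0) (u i) (endpoint γ)
    have h3 : R < boundaryProduct (γ.1 0) (u i) (endpoint γ) := by linarith
    obtain ⟨t, ht⟩ := (((tendsto_gromovProduct hX (γ.1 0) (u i) _).comp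
      (tendsto_ray γ)).eventually (lt_mem_nhds h3)).exists
    exact hR ⟨t, ht.le⟩

theorem tendsto_dist_of_toBoundary (hX : IsBusemannRegularHyperbolic X) (o : X) {ξ : Boundary X}
    {ι : Type*} {F : Filter ι} {u : ι → X} (h : Tendsto u F (toBoundary ξ)) :
    Tendsto (fun i => dist (u i) o) F atTop :=
  tendsto_atTop_mono (fun i => boundaryProduct_le_dist hX o (u i) ξ)
    ((tendsto_toBoundary_iff hX o).1 h)

/-- Two points which both fellow-travel with `ξ` up to time `t`. -/
theorem FourPoint.dist_le_of_boundaryProduct {α : ℝ} (hα : FourPoint X α)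
    (hX : IsBusemannRegularHyperbolic X) {o x y : X} {ξ : Boundary X} {a : ℝ}
    (hx : a ≤ boundaryProduct o x ξ) (hy : a ≤ boundaryProduct o y ξ) :
    dist x y ≤ dist x o + dist y o - 2 * a + 2 * α := by
  have h := hα.gromovProduct_ge hX o x y ξ
  have := le_min hx hy
  rw [gromovProduct] at h
  linarith

/-- Makes the asymptotic relation quantitative: the bound depends only on the starting points, so it
survives limits of rays. -/
theorem FourPoint.dist_asymptotic {α : ℝ} (hα : FourPoint X α)
    (hX : IsBusemannRegularHyperbolic X) {γ γ' : GeodesicRay X}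
    (h : endpoint γ = endpoint γ') (t : ℝ≥0) :
    dist (γ.1 t) (γ'.1 t) ≤ 3 * dist (γ.1 0) (γ'.1 0) + 2 * α := by
  have h1 := boundaryProduct_ray hX γ t
  have h2 := boundaryProduct_ray hX γ' t
  have h3 := boundaryProduct_basepoint hX (γ'.1 0) (γ.1 0) (γ'.1 t) (endpoint γ')
  have h4 := dist_triangle_right (γ'.1 t) (γ.1 0) (γ'.1 0)
  have h5 := dist_triangle (γ'.1 t) (γ'.1 0) (γ.1 0)
  have h6 := hα.dist_le_of_boundaryProduct hX (o := γ.1 0) (x := γ.1 t) (y := γ'.1 t)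
    (ξ := endpoint γ') (a := t - dist (γ.1 0) (γ'.1 0))
    (by rw [← h, h1]; linarith [dist_nonneg (x := γ.1 0) (y := γ'.1 0)])
    (by rw [dist_comm (γ.1 0)]; linarith)
  rw [dist_ray_zero, dist_comm (γ'.1 0)] at h5
  rw [dist_ray_zero] at h6
  linarith

/-- A point w far out in the directions of both ξ and η forces the two rays to be close up to any
prescribed time, with a bound independent of that time. -/
theorem boundary_eq_of_frequently {α : ℝ} (hα : FourPoint X α)
    (hX : IsBusemannRegularHyperbolic X) {o : X} {ξ η : Boundary X}
    (h : ∀ R : ℝ, ∃ w, R ≤ boundaryProduct o w ξ ∧ R ≤ boundaryProduct o w η) : ξ = η := by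
  obtain ⟨γ, rfl⟩ := exists_endpoint_eq ξ
  obtain ⟨γ', rfl⟩ := exists_endpoint_eq η
  refine Quotient.sound ⟨3 * (dist (γ.1 0) o + dist (γ'.1 0) o) + 4 * α, fun t => ?_⟩
  obtain ⟨w, h1, h2⟩ := h (t + dist (γ.1 0) o + dist (γ'.1 0) o)
  have n1 := dist_nonneg (x := γ.1 0) (y := o)
  have n2 := dist_nonneg (x := γ'.1 0) (y := o)
  have a1 := boundaryProduct_basepoint hX (γ.1 0) o (γ.1 t) (endpoint γ)
  have a2 := boundaryProduct_basepoint hX (γ'.1 0) o (γ'.1 t) (endpoint γ')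
  rw [boundaryProduct_ray hX] at a1 a2
  have b1 := hα.gromovProduct_ge hX o (γ.1 t) w (endpoint γ)
  have b2 := hα.gromovProduct_ge hX o w (γ'.1 t) (endpoint γ')
  have c1 : t - dist (γ.1 0) o ≤ min (boundaryProduct o (γ.1 t) (endpoint γ))
    (boundaryProduct o w (endpoint γ)) := le_min (by linarith) (by linarith)
  have c2 : t - dist (γ'.1 0) o ≤ min (boundaryProduct o w (endpoint γ'))
    (boundaryProduct o (γ'.1 t) (endpoint γ')) := le_min (by linarith) (by linarith)
  have d := hα.2 o (γ.1 t) (γ'.1 t) w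
  have e : t - dist (γ.1 0) o - dist (γ'.1 0) o - α ≤
    min (gromovProduct o (γ.1 t) w) (gromovProduct o w (γ'.1 t)) :=
      le_min (by linarith) (by linarith)
  have f1 := dist_triangle (γ.1 t) (γ.1 0) o
  have f2 := dist_triangle (γ'.1 t) (γ'.1 0) o
  rw [dist_ray_zero] at f1 f2
  have d' := e.trans (sub_le_iff_le_add.1 d)
  rw [gromovProduct] at d'
  linarith

theorem boundary_eq_of_tendsto {α : ℝ} (hα : FourPoint X α)
    (hX : IsBusemannRegularHyperbolic X) {ξ η : Boundary X}
    {ι : Type*} {F : Filter ι} [F.NeBot] {u : ι → X} (h1 : Tendsto u F (toBoundary ξ))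
    (h2 : Tendsto u F (toBoundary η)) : ξ = η := by
  obtain ⟨i0⟩ := Filter.nonempty_of_neBot F
  refine boundary_eq_of_frequently hα hX (o := u i0) fun R => ?_
  obtain ⟨i, hi, hi'⟩ := ((((tendsto_toBoundary_iff hX (u i0)).1 h1).eventually_ge_atTop R).and
    (((tendsto_toBoundary_iff hX (u i0)).1 h2).eventually_ge_atTop R)).exists
  exact ⟨u i, hi, hi'⟩

theorem busemann_smul (hX : IsBusemannRegularHyperbolic X) (g : X ≃ᵢ X) (ξ : Boundary X)
    (x y : X) : busemann (g • ξ) (g x) (g y) = busemann ξ x y := by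
  obtain ⟨γ, rfl⟩ := exists_endpoint_eq ξ
  refine tendsto_nhds_unique ((tendsto_busemann hX _ _ _).comp (tendsto_ray (mapRay g γ))) ?_
  refine ((tendsto_busemann hX (endpoint γ) x y).comp (tendsto_ray γ)).congr fun t => ?_
  simp [mapRay, g.isometry.dist_eq]

theorem boundaryProduct_smul (hX : IsBusemannRegularHyperbolic X) (g : X ≃ᵢ X) (ξ : Boundary X)
    (o x : X) : boundaryProduct (g o) (g x) (g • ξ) = boundaryProduct o x ξ := by
  rw [boundaryProduct, boundaryProduct, busemann_smul hX, g.isometry.dist_eq]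

theorem tendsto_toBoundary_smul (hX : IsBusemannRegularHyperbolic X) (g : X ≃ᵢ X)
    {ξ : Boundary X} {ι : Type*} {F : Filter ι} {u : ι → X} (h : Tendsto u F (toBoundary ξ)) :
    Tendsto (fun i => g (u i)) F (toBoundary (g • ξ)) := by
  rcases isEmpty_or_nonempty X with hE | ⟨⟨o⟩⟩
  · obtain ⟨γ, -⟩ := exists_endpoint_eq ξ
    exact hE.elim (γ.1 0)
  · rw [tendsto_toBoundary_iff hX (g o)]
    simpa only [boundaryProduct_smul hX] using (tendsto_toBoundary_iff hX o).1 h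

/-! ### Limits of segments and rays -/

/-- Geodesic segments, prolonged by a constant map. -/
theorem exists_segment (hX : IsBusemannRegularHyperbolic X) (x y : X) :
    ∃ f : ℝ≥0 → X, f 0 = x ∧ (∀ s : ℝ≥0, (s : ℝ) ≤ dist x y → dist (f s) y = dist x y - s) ∧
      (∀ s : ℝ≥0, dist x (f s) ≤ s) ∧
      ∀ s t : ℝ≥0, (s : ℝ) ≤ dist x y → (t : ℝ) ≤ dist x y →
        dist (f s) (f t) = |(s : ℝ) - t| := by
  obtain ⟨c, ⟨hc, h0, h1⟩, -⟩ := hX.uniquelyGeodesic x y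
  have hmem : ∀ s : ℝ≥0, min (s : ℝ) (dist x y) ∈ Set.Icc (0 : ℝ) (dist x y) := fun s =>
    ⟨le_min s.2 dist_nonneg, min_le_right _ _⟩
  have h0' : ∀ s : ℝ≥0, dist x (c ⟨min (s : ℝ) (dist x y), hmem s⟩) = min (s : ℝ) (dist x y) := by
    intro s
    refine (congrArg (dist · _) h0.symm).trans ?_
    rw [hc.dist_eq, Subtype.dist_eq, dist_comm, Real.dist_eq, sub_zero,
      abs_of_nonneg (hmem s).1]
  have h1' : ∀ s : ℝ≥0, dist (c ⟨min (s : ℝ) (dist x y), hmem s⟩) y =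
      dist x y - min (s : ℝ) (dist x y) := by
    intro s
    refine (congrArg (dist _ ·) h1.symm).trans ?_
    rw [hc.dist_eq, Subtype.dist_eq, dist_comm, Real.dist_eq,
      abs_of_nonneg (sub_nonneg.2 (hmem s).2)]
  refine ⟨fun s => c ⟨min (s : ℝ) (dist x y), hmem s⟩, ?_, ?_, ?_, ?_⟩
  · rw [← dist_le_zero, dist_comm, h0']
    simp
  · intro s hs
    rw [h1', min_eq_left hs]
  · intro s
    rw [h0']
    exact min_le_left _ _
  · intro s t hs ht
    rw [hc.dist_eq, Subtype.dist_eq, Real.dist_eq]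
    simp only [min_eq_left hs, min_eq_left ht]

/-- Maps `f i` which are eventually isometric on bounded intervals converge pointwise along an
ultrafilter to a geodesic ray. -/
theorem exists_ray_tendsto [ProperSpace X] {ι : Type*} (U : Ultrafilter ι) (o : X)
    (f : ι → ℝ≥0 → X) (h0 : ∀ i, f i 0 = o) (hle : ∀ i s, dist o (f i s) ≤ s)
    (hd : ∀ s t : ℝ≥0, ∀ᶠ i in (U : Filter ι), dist (f i s) (f i t) = |(s : ℝ) - t|) :
    ∃ γ : GeodesicRay X, γ.1 0 = o ∧ ∀ s, Tendsto (fun i => f i s) U (𝓝 (γ.1 s)) := by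
  have hlim : ∀ s, ∃ x, Tendsto (fun i => f i s) U (𝓝 x) := by
    intro s
    have hc := (isCompact_closedBall o (s : ℝ)).ultrafilter_le_nhds (U.map fun i => f i s) (by
      rw [le_principal_iff]
      exact Filter.mem_map.2 (Filter.univ_mem' fun i => by
        rw [Set.mem_preimage, Metric.mem_closedBall, dist_comm]
        exact hle i s))
    obtain ⟨x, -, hx⟩ := hc
    exact ⟨x, hx⟩
  choose γ hγ using hlim
  refine ⟨⟨γ, Isometry.of_dist_eq fun s t => ?_⟩, ?_, hγ⟩
  · rw [NNReal.dist_eq]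
    exact tendsto_nhds_unique ((hγ s).dist (hγ t))
      (tendsto_const_nhds.congr' ((hd s t).mono fun i hi => hi.symm))
  · exact tendsto_nhds_unique (hγ 0) (by simp [h0])

/-- Unbounded sequences subconverge to a boundary point. -/
theorem exists_tendsto_endpoint [ProperSpace X] {α : ℝ} (hα : FourPoint X α)
    (hX : IsBusemannRegularHyperbolic X) {ι : Type*} (U : Ultrafilter ι) (o : X) {y : ι → X}
    (hy : Tendsto (fun i => dist o (y i)) U atTop) :
    ∃ γ : GeodesicRay X, γ.1 0 = o ∧ Tendsto y U (toBoundary (endpoint γ)) := by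
  choose f h0 h2 h3 h4 using fun i => exists_segment hX o (y i)
  obtain ⟨γ, hγ0, hγ⟩ := exists_ray_tendsto U o f h0 h3 fun s t => by
    filter_upwards [hy.eventually_ge_atTop s, hy.eventually_ge_atTop t] with i hs ht
    exact h4 i s t hs ht
  refine ⟨γ, hγ0, ?_⟩
  rw [tendsto_toBoundary_iff hX o, tendsto_atTop]
  intro R
  -- In R + α + 1, the 1 absorbs the distance from `f i s` to its limit `γ.1 s`, and α the loss in
  -- the four-point inequality.
  filter_upwards [hy.eventually_ge_atTop ((R + α + 1).toNNReal : ℝ),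
    (hγ (R + α + 1).toNNReal).eventually (Metric.ball_mem_nhds _ one_pos)] with i hi hi'
  set s := (R + α + 1).toNNReal
  have hs : R + α + 1 ≤ s := Real.le_coe_toNNReal _
  have a1 := h2 i s hi
  have a2 := dist_triangle (y i) (f i s) (γ.1 s)
  have a3 : dist (f i s) (γ.1 s) < 1 := hi'
  have a4 := hα.boundaryProduct_ge hX o (y i) (γ.1 s) (endpoint γ)
  have a5 := boundaryProduct_ray hX γ s
  have a6 := dist_ray_zero γ s
  rw [hγ0] at a5 a6
  have a7 : (s : ℝ) - 1 ≤ gromovProduct o (y i) (γ.1 s) := by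
    rw [gromovProduct, a6, dist_comm (y i) o]
    rw [dist_comm (y i) (f i s)] at a2
    linarith
  have a8 := le_min a7 (show (s : ℝ) - 1 ≤ boundaryProduct o (γ.1 s) (endpoint γ) by
    rw [a5]; linarith)
  linarith

theorem exists_ray_from [ProperSpace X] {α : ℝ} (hα : FourPoint X α)
    (hX : IsBusemannRegularHyperbolic X) (o : X) (ξ : Boundary X) :
    ∃ γ : GeodesicRay X, γ.1 0 = o ∧ endpoint γ = ξ := by
  obtain ⟨γ, rfl⟩ := exists_endpoint_eq ξ
  obtain ⟨U, hU⟩ := Ultrafilter.exists_le (atTop : Filter ℝ≥0)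
  have h1 : Tendsto γ.1 (U : Filter ℝ≥0) (toBoundary (endpoint γ)) := (tendsto_ray γ).mono_left hU
  obtain ⟨γ', h0, h2⟩ := exists_tendsto_endpoint hα hX U o (y := γ.1) (by
    simpa only [dist_comm o] using tendsto_dist_of_toBoundary hX o h1)
  exact ⟨γ', h0, boundary_eq_of_tendsto hα hX h2 h1⟩

/-! ### Separated boundary points -/

/-- `Separated o ξ η c` says that the Gromov product of the boundary points `ξ` and `η` based at
`o` is (coarsely) at most `c`. -/
def Separated (o : X) (ξ η : Boundary X) (c : ℝ) : Prop :=
  ∀ w, min (boundaryProduct o w ξ) (boundaryProduct o w η) ≤ c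

theorem exists_separated {α : ℝ} (hα : FourPoint X α)
    (hX : IsBusemannRegularHyperbolic X) (o : X) {ξ η : Boundary X} (h : ξ ≠ η) :
    ∃ c, Separated o ξ η c := by
  by_contra! hc
  refine h (boundary_eq_of_frequently hα hX (o := o) fun R => ?_)
  have hR := hc R
  simp only [Separated, not_forall, not_le] at hR
  obtain ⟨w, hw⟩ := hR
  exact ⟨w, (lt_min_iff.1 hw).1.le, (lt_min_iff.1 hw).2.le⟩

theorem Separated.smul (hX : IsBusemannRegularHyperbolic X) {o : X} {ξ η : Boundary X} {c : ℝ}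
    (h : Separated o ξ η c) (g : X ≃ᵢ X) : Separated (g o) (g • ξ) (g • η) c := by
  intro w
  have := h (g.symm w)
  rwa [← boundaryProduct_smul hX g ξ, ← boundaryProduct_smul hX g η, g.apply_symm_apply] at this

theorem Separated.ne (hX : IsBusemannRegularHyperbolic X) {o : X} {ξ η : Boundary X} {c : ℝ}
    (h : Separated o ξ η c) : ξ ≠ η := by
  rintro rfl
  obtain ⟨w, hw⟩ := (((tendsto_toBoundary_iff hX o).1 
    (tendsto_id (x := toBoundary ξ))).eventually_gt_atTop c).exists
  exact absurd (h w) (by simpa using hw)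

/-- If `ξ` and `η` are separated as seen from `o`, then every point is separated from one
of them. -/
theorem FourPoint.separated_or {α : ℝ} (hα : FourPoint X α)
    (hX : IsBusemannRegularHyperbolic X) {o : X} {ξ η : Boundary X} {c : ℝ}
    (h : Separated o ξ η c) (ζ : Boundary X) :
    Separated o ξ ζ (c + 2 * α + 1) ∨ Separated o η ζ (c + 2 * α + 1) := by
  by_contra! hc
  simp only [Separated, not_forall, not_le] at hc
  obtain ⟨⟨z, hz⟩, ⟨w, hw⟩⟩ := hc
  rw [lt_min_iff] at hz hw
  have h1 := hα.gromovProduct_ge hX o z w ζ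
  have h2 := le_min hz.2.le hw.2.le
  have h3 := hα.boundaryProduct_ge hX o z w η
  have h4 : c + α + 1 ≤ min (gromovProduct o z w) (boundaryProduct o w η) :=
    le_min (by linarith) (by linarith [hα.1])
  have h5 : c + 1 ≤ min (boundaryProduct o z ξ) (boundaryProduct o z η) :=
    le_min (by linarith [hα.1]) (by linarith)
  linarith [h z]

/-! ### Tubes and shadows -/

/-- The boundary points which fellow-travel with `γ` up to time `R`. -/
def tube (α : ℝ) (γ : GeodesicRay X) (R : ℝ≥0) : Set (Boundary X) :=
  {η | ∃ γ' : GeodesicRay X, γ'.1 0 = γ.1 0 ∧ endpoint γ' = η ∧ dist (γ'.1 R) (γ.1 R) ≤ 6 * α}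

theorem mem_tube_of_boundaryProduct [ProperSpace X] {α : ℝ} (hα : FourPoint X α)
    (hX : IsBusemannRegularHyperbolic X) {γ : GeodesicRay X} {R : ℝ≥0} {η : Boundary X}
    (h : R - 2 * α ≤ boundaryProduct (γ.1 0) (γ.1 R) η) : η ∈ tube α γ R := by
  obtain ⟨γ', h0, rfl⟩ := exists_ray_from hα hX (γ.1 0) η
  refine ⟨γ', h0, rfl, ?_⟩
  have h1 := boundaryProduct_ray hX γ' R
  have h2 := dist_ray_zero γ' R
  rw [h0] at h1 h2
  -- Both points are at distance R from the start, so the bound is 2R − 2(R − 2α) + 2α = 6α, the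
  -- width chosen for `tube`.
  have := hα.dist_le_of_boundaryProduct hX (a := R - 2 * α)
    (show R - 2 * α ≤ boundaryProduct (γ.1 0) (γ'.1 R) (endpoint γ') by linarith [hα.1]) h
  rw [h2, dist_ray_zero] at this
  linarith

theorem mem_tube_of_point [ProperSpace X] {α : ℝ} (hα : FourPoint X α)
    (hX : IsBusemannRegularHyperbolic X) {γ : GeodesicRay X} {R : ℝ≥0} {η : Boundary X} {w : X}
    (h : R ≤ boundaryProduct (γ.1 0) w η)
    (h' : R ≤ boundaryProduct (γ.1 0) w (endpoint γ)) : η ∈ tube α γ R := by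
  refine mem_tube_of_boundaryProduct hα hX ?_
  have h1 := boundaryProduct_ray hX γ R
  have h3 := hα.gromovProduct_ge hX (γ.1 0) (γ.1 R) w (endpoint γ)
  rw [h1, min_eq_left h'] at h3
  have h4 := hα.boundaryProduct_ge hX (γ.1 0) (γ.1 R) w η
  have h5 := le_min h3 (show R - α ≤ boundaryProduct (γ.1 0) w η by linarith [hα.1])
  linarith

/-- Closedness is tested on the space of rays, of which the boundary is a quotient. Witnessing rays
from the common starting point converge along an ultrafilter, and `FourPoint.dist_asymptotic` keeps
the limit asymptotic to the right ray. Tubes are thus measurable, which is why they replace shadows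
where disjointness is used. -/
theorem isClosed_tube [ProperSpace X] {α : ℝ} (hα : FourPoint X α)
    (hX : IsBusemannRegularHyperbolic X) (γ : GeodesicRay X) (R : ℝ≥0) :
    IsClosed (tube α γ R) := by
  have hq : IsQuotientMap (endpoint : GeodesicRay X → Boundary X) := isQuotientMap_quotient_mk'
  rw [← hq.isClosed_preimage, isClosed_iff_ultrafilter]
  intro ρ U hU hmem
  have : ∀ σ : GeodesicRay X, ∃ γ' : GeodesicRay X, γ'.1 0 = γ.1 0 ∧
      (σ ∈ endpoint ⁻¹' tube α γ R →
        endpoint γ' = endpoint σ ∧ dist (γ'.1 R) (γ.1 R) ≤ 6 * α) := by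
    intro σ
    by_cases h : σ ∈ endpoint ⁻¹' tube α γ R
    · obtain ⟨γ', h0, h⟩ := h
      exact ⟨γ', h0, fun _ => h⟩
    · exact ⟨γ, rfl, fun h' => absurd h' h⟩
  choose G hG0 hG using this
  have hU' : ∀ t, Tendsto (fun σ : GeodesicRay X => σ.1 t) U (𝓝 (ρ.1 t)) := fun t =>
    (((continuous_apply t).comp continuous_subtype_val).tendsto ρ).mono_left hU
  obtain ⟨γ', h0, hlim⟩ := exists_ray_tendsto U (γ.1 0) (fun σ => (G σ).1) hG0
    (fun σ s => by rw [← hG0 σ, dist_comm, dist_ray_zero])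
    (fun s t => Eventually.of_forall fun σ => dist_ray _ s t)
  refine ⟨γ', h0, Quotient.sound ⟨3 * dist (γ.1 0) (ρ.1 0) + 2 * α, fun t => ?_⟩, ?_⟩
  · refine le_of_tendsto_of_tendsto ((hlim t).dist (hU' t))
      (((tendsto_const_nhds.dist (hU' 0)).const_mul 3).add_const (2 * α)) ?_
    filter_upwards [hmem] with σ hσ
    have := hα.dist_asymptotic hX (hG σ hσ).1 t
    rwa [hG0] at this
  · refine le_of_tendsto ((hlim R).dist tendsto_const_nhds) ?_
    filter_upwards [hmem] with σ hσ
    exact (hG σ hσ).2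

theorem tube_boundaryProduct {α : ℝ}
    (hX : IsBusemannRegularHyperbolic X) {γ : GeodesicRay X} {R : ℝ≥0} {η : Boundary X}
    (h : η ∈ tube α γ R) : R - 6 * α ≤ boundaryProduct (γ.1 0) (γ.1 R) η := by
  obtain ⟨γ', h0, rfl, h⟩ := h
  have h1 := boundaryProduct_ray hX γ' R
  rw [h0] at h1
  have := boundaryProduct_le_add_dist hX (γ.1 0) (γ'.1 R) (γ.1 R) (endpoint γ')
  linarith

/-- A compact set of boundary points avoiding `ξ` is uniformly separated from `ξ`. -/
theorem exists_separated_of_isCompact [ProperSpace X] {α : ℝ} (hα : FourPoint X α)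
    (hX : IsBusemannRegularHyperbolic X) (o : X) {ξ : Boundary X} {K : Set (Boundary X)}
    (hK : IsCompact K) (hξ : ξ ∉ K) : ∃ c, ∀ η ∈ K, Separated o η ξ c := by
  obtain ⟨γ, rfl, rfl⟩ := exists_ray_from hα hX o ξ
  -- Every η in K leaves some tube around the ray to ξ. The complements of the tubes are open, so
  -- compactness bounds the time at which this happens.
  obtain ⟨t, ht⟩ := hK.elim_finite_subcover (fun R : ℝ≥0 => (tube α γ R)ᶜ)
    (fun R => (isClosed_tube hα hX γ R).isOpen_compl) (by
      intro η hη
      rw [Set.mem_iUnion]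
      by_contra! h
      refine hξ ?_
      convert hη
      refine boundary_eq_of_frequently hα hX (o := γ.1 0) fun R => ?_
      refine ⟨γ.1 (R + 6 * α).toNNReal, ?_, ?_⟩
      · rw [boundaryProduct_ray hX]
        linarith [Real.le_coe_toNNReal (R + 6 * α), hα.1]
      · have := tube_boundaryProduct hX (not_not.1 (h (R + 6 * α).toNNReal))
        linarith [Real.le_coe_toNNReal (R + 6 * α)])
  refine ⟨((t.sup id : ℝ≥0) : ℝ), fun η hη w => ?_⟩
  obtain ⟨R, hR, hηR⟩ := Set.mem_iUnion₂.1 (ht hη)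
  by_contra! hw
  rw [lt_min_iff] at hw
  have hle : (R : ℝ) ≤ (t.sup id : ℝ≥0) := Finset.le_sup (f := id) hR
  exact hηR (mem_tube_of_point hα hX (hle.trans hw.1.le) (hle.trans hw.2.le))

theorem endpoint_mem_shadow (hX : IsBusemannRegularHyperbolic X) (γ : GeodesicRay X) (t : ℝ≥0) :
    endpoint γ ∈ shadow γ t := by
  intro s hs
  have := hs (s + 1)
  rw [busemann_ray hX, busemann_ray hX] at this
  push_cast at this
  linarith

/-- A projection s of η satisfies −s ≤ β_η(γ s, γ 0) ≤ β_η(γ R, γ 0) ≤ 12α − R. Together with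
`shadow_subset_tube` this sandwiches shadows between tubes, up to a bounded shift in time. -/
theorem tube_subset_shadow {α : ℝ}
    (hX : IsBusemannRegularHyperbolic X) (γ : GeodesicRay X) {R t : ℝ≥0}
    (h : t + 12 * α < R) : tube α γ R ⊆ shadow γ t := by
  intro η hη s hs
  have h1 := tube_boundaryProduct hX hη
  have h2 := hs R
  have h3 := neg_dist_le_busemann hX η (γ.1 s) (γ.1 0)
  rw [boundaryProduct, dist_ray_zero] at h1
  rw [dist_ray_zero] at h3
  rw [← NNReal.coe_lt_coe]
  linarith

theorem continuous_busemann (hX : IsBusemannRegularHyperbolic X) (ξ : Boundary X) (o : X) :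
    Continuous fun x => busemann ξ x o := by
  refine (LipschitzWith.of_dist_le_mul (K := 1) fun x y => ?_).continuous
  have h := busemann_add hX ξ x y o
  have h1 := busemann_le_dist hX ξ x y
  have h2 := neg_dist_le_busemann hX ξ x y
  rw [Real.dist_eq, abs_le]
  simp only [NNReal.coe_one, one_mul]
  constructor <;> linarith

/-- Membership in a shadow is a condition on all projections, so nothing follows from it unless a
projection exists. Separation from the endpoint makes the Busemann function eventually nonnegative
along the ray; since it vanishes at the start, its minimum is attained. -/
theorem exists_isProjection {α : ℝ} (hα : FourPoint X α)
    (hX : IsBusemannRegularHyperbolic X) (γ : GeodesicRay X) {η : Boundary X}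
    (h : η ≠ endpoint γ) : ∃ s, IsProjection γ η s := by
  obtain ⟨c, hc⟩ := exists_separated hα hX (γ.1 0) h
  have hcont : Continuous fun s : ℝ≥0 => busemann η (γ.1 s) (γ.1 0) :=
    (continuous_busemann hX η (γ.1 0)).comp γ.2.continuous
  have h0 : busemann η (γ.1 0) (γ.1 0) = 0 := busemann_self hX _ _
  refine (hcont.exists_forall_le' 0 ?_)
  rw [h0]
  have : ∀ᶠ s : ℝ≥0 in atTop, 0 ≤ busemann η (γ.1 s) (γ.1 0) := by
    filter_upwards [eventually_gt_atTop (2 * c).toNNReal, eventually_gt_atTop c.toNNReal]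
      with s hs hs'
    have h1 := hc (γ.1 s)
    rw [boundaryProduct_ray hX] at h1
    have hs1 : 2 * c < s := (Real.le_coe_toNNReal _).trans_lt hs
    have hs2 : c < s := (Real.le_coe_toNNReal _).trans_lt hs'
    rcases min_le_iff.1 h1 with h1 | h1
    · rw [boundaryProduct, dist_ray_zero] at h1
      linarith
    · linarith
  obtain ⟨b, hb⟩ := eventually_atTop.1 this
  rw [Filter.eventually_iff, mem_cocompact]
  exact ⟨Set.Icc 0 b, isCompact_Icc, fun s hs => hb s (le_of_not_ge fun hsb =>
    hs ⟨bot_le, hsb⟩)⟩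

theorem shadow_subset_tube [ProperSpace X] {α : ℝ} (hα : FourPoint X α)
    (hX : IsBusemannRegularHyperbolic X) (γ : GeodesicRay X) {R t : ℝ≥0}
    (h : R + 2 * α ≤ t) : shadow γ t ⊆ tube α γ R := by
  intro η hη
  refine mem_tube_of_boundaryProduct hα hX ?_
  by_cases he : η = endpoint γ
  · rw [he, boundaryProduct_ray hX]
    linarith [hα.1]
  obtain ⟨s, hs⟩ := exists_isProjection hα hX γ he
  have hts : (t : ℝ) < s := hη s hs
  have h1 := hs R
  have h2 := hα.dist_add_busemann_le hX (γ.1 0) (γ.1 s) (γ.1 0) (γ.1 R) η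
  rw [busemann_self hX, dist_ray_zero, dist_ray, dist_comm, dist_ray_zero,
    abs_of_nonneg (by linarith [hα.1])] at h2
  rw [boundaryProduct, dist_ray_zero]
  rcases le_max_iff.1 (sub_le_iff_le_add.2 h2) with h2 | h2
  · linarith [hα.1]
  · linarith [hα.1]

/-! ### Limit points and parabolic stabilizers -/

theorem mem_limitSet_iff (hX : IsBusemannRegularHyperbolic X) {Γ : Subgroup (X ≃ᵢ X)} (o : X)
    {ξ : Boundary X} : ξ ∈ limitSet Γ ↔ ∀ R : ℝ, ∃ g ∈ Γ, R ≤ boundaryProduct o (g o) ξ := by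
  constructor
  · rintro ⟨x, u, hu, h⟩ R
    obtain ⟨n, hn⟩ := (((tendsto_toBoundary_iff hX o).1 h).eventually_ge_atTop
      (R + dist x o)).exists
    obtain ⟨g, hg, hgu⟩ := hu n
    refine ⟨g, hg, ?_⟩
    have := boundaryProduct_le_add_dist hX o (g x) (g o) ξ
    rw [hgu, ← hgu, g.isometry.dist_eq, hgu] at this
    linarith
  · intro h
    choose g hg h using h
    exact ⟨o, fun n => g n o, fun n => ⟨g n, hg n, rfl⟩, (tendsto_toBoundary_iff hX o).2
      (tendsto_atTop_mono (fun n : ℕ => h n) tendsto_natCast_atTop_atTop)⟩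

theorem smul_mem_limitSet (hX : IsBusemannRegularHyperbolic X) {Γ : Subgroup (X ≃ᵢ X)}
    {g : X ≃ᵢ X} (hg : g ∈ Γ) {ξ : Boundary X} (h : ξ ∈ limitSet Γ) : g • ξ ∈ limitSet Γ := by
  obtain ⟨x, u, hu, h⟩ := h
  refine ⟨x, fun n => g (u n), fun n => ?_, tendsto_toBoundary_smul hX g h⟩
  obtain ⟨k, hk, hku⟩ := hu n
  exact ⟨g * k, mul_mem hg hk, congrArg g hku⟩

theorem conj_mem_stab {Γ : Subgroup (X ≃ᵢ X)} {g h : X ≃ᵢ X} (hg : g ∈ Γ) {ξ : Boundary X}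
    (h1 : h ∈ stab Γ ξ) : g * h * g⁻¹ ∈ stab Γ (g • ξ) := by
  refine ⟨Γ.mul_mem (Γ.mul_mem hg h1.1) (Γ.inv_mem hg), ?_⟩
  have : h • ξ = ξ := h1.2
  change (g * h * g⁻¹) • g • ξ = g • ξ
  rw [smul_smul, inv_mul_cancel_right, mul_smul, this]

theorem IsLoxodromic.conj {h : X ≃ᵢ X} (hh : IsLoxodromic h) (g : X ≃ᵢ X) :
    IsLoxodromic (g * h * g⁻¹) := by
  obtain ⟨x, c, hc, h⟩ := hh
  refine ⟨g x, c, hc, fun n => (h n).trans_eq ?_⟩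
  rw [conj_pow, IsometryEquiv.mul_apply, IsometryEquiv.mul_apply, IsometryEquiv.inv_apply_self,
    g.isometry.dist_eq]

theorem smul_mem_parabolicPoints (hX : IsBusemannRegularHyperbolic X) {Γ : Subgroup (X ≃ᵢ X)}
    {g : X ≃ᵢ X} (hg : g ∈ Γ) {p : Boundary X} (h : p ∈ parabolicPoints Γ) :
    g • p ∈ parabolicPoints Γ := by
  refine ⟨smul_mem_limitSet hX hg h.1, ?_, fun k hk hlox => ?_⟩
  · refine Set.infinite_of_injOn_mapsTo (f := fun k => g * k * g⁻¹) ?_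
      (fun k hk => conj_mem_stab hg hk) h.2.1
    intro a _ b _ hab
    exact mul_left_cancel (mul_right_cancel hab)
  · have h1 := conj_mem_stab (inv_mem hg) hk
    rw [inv_smul_smul] at h1
    exact h.2.2 _ h1 (hlox.conj _)

/-- A parabolic subgroup preserves the horofunction at its fixed point. -/
theorem busemann_stab (hX : IsBusemannRegularHyperbolic X) {Γ : Subgroup (X ≃ᵢ X)}
    {p : Boundary X} (hp : p ∈ parabolicPoints Γ) {h : X ≃ᵢ X} (hh : h ∈ stab Γ p) (x : X) :
    busemann p (h x) x = 0 := by
  have hfix : h • p = p := hh.2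
  have key : ∀ y, busemann p (h y) (h x) = busemann p y x := fun y => by
    conv_lhs => rw [← hfix]
    exact busemann_smul hX h p y x
  -- The horofunction shifts additively under powers of h, so a nonzero shift would force linear
  -- displacement, making h loxodromic.
  have hpow : ∀ n : ℕ, busemann p ((h ^ n) x) x = n * busemann p (h x) x := by
    intro n
    induction n with
    | zero => simp [busemann_self hX]
    | succ n ih =>
      rw [pow_succ', IsometryEquiv.mul_apply, ← busemann_add hX p _ (h x) x, key, ih]
      push_cast
      ring
  by_contra hne
  refine hp.2.2 h hh ⟨x, |busemann p (h x) x|, abs_pos.2 hne, fun n => ?_⟩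
  have h1 := busemann_le_dist hX p ((h ^ n) x) x
  have h2 := neg_dist_le_busemann hX p ((h ^ n) x) x
  rw [dist_comm, mul_comm, ← Nat.abs_cast n, ← abs_mul, ← hpow]
  exact abs_le.2 ⟨h2, h1⟩

theorem boundaryProduct_stab (hX : IsBusemannRegularHyperbolic X) {Γ : Subgroup (X ≃ᵢ X)}
    {p : Boundary X} {h : X ≃ᵢ X} (hh : h ∈ stab Γ p) (x y : X) :
    boundaryProduct (h x) (h y) p = boundaryProduct x y p := by
  have hfix : h • p = p := hh.2
  conv_lhs => rw [← hfix]
  exact boundaryProduct_smul hX h p x y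

/-- The orbit enters every horoball centered at a conical limit point. -/
theorem IsConical.exists_busemann_le (hX : IsBusemannRegularHyperbolic X)
    {Γ : Subgroup (X ≃ᵢ X)} {ξ : Boundary X} (h : IsConical Γ ξ) (o : X) (M : ℝ) :
    ∃ g ∈ Γ, busemann ξ (g o) o ≤ M := by
  obtain ⟨x, u, γ, C, rfl, hu, hlim, hC⟩ := h
  obtain ⟨n, hn⟩ := ((tendsto_dist_of_toBoundary hX o hlim).eventually_ge_atTop
    (2 * dist (γ.1 0) o + 2 * C + dist x o - M)).exists
  obtain ⟨g, hg, hgu⟩ := hu n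
  obtain ⟨t, ht⟩ := hC n
  refine ⟨g, hg, ?_⟩
  have a1 := busemann_ray hX γ t 0
  have a2 := busemann_add hX (endpoint γ) (γ.1 t) (γ.1 0) o
  have a3 := busemann_le_dist hX (endpoint γ) (γ.1 0) o
  have a4 := busemann_add hX (endpoint γ) (u n) (γ.1 t) o
  have a5 := busemann_le_dist hX (endpoint γ) (u n) (γ.1 t)
  have a6 := busemann_add hX (endpoint γ) (g o) (u n) o
  have a7 := busemann_le_dist hX (endpoint γ) (g o) (u n)
  have a8 : dist (g o) (u n) = dist x o := by rw [← hgu, g.isometry.dist_eq, dist_comm]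
  have a9 := dist_triangle4 (u n) (γ.1 t) (γ.1 0) o
  rw [dist_ray_zero] at a9
  rw [NNReal.coe_zero] at a1
  linarith

/-! ### Horoballs and depth -/

/-- A `Γ`-invariant family of disjoint horoballs `{busemann p · o < c p}`. -/
structure IsCuspFamily (Γ : Subgroup (X ≃ᵢ X)) (o : X) (c : Boundary X → ℝ) : Prop where
  equivariant : ∀ g ∈ Γ, ∀ p ∈ parabolicPoints Γ, c (g • p) = c p + busemann (g • p) (g o) o
  disjoint : ∀ p ∈ parabolicPoints Γ, ∀ q ∈ parabolicPoints Γ, p ≠ q → ∀ x,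
    busemann p x o < c p → c q ≤ busemann q x o

/-- The depth of `x` in the horoball `{busemann p · o < c p}`. -/
def depth (o : X) (c : Boundary X → ℝ) (p : Boundary X) (x : X) : ℝ := c p - busemann p x o

/-- Equivariance of the sets H_p gives equivariance of the levels only if a horoball determines its
level. It does as soon as its complement is nonempty: along a ray to p from an outside point the
Busemann function takes all smaller values. A second parabolic point supplies the outside point, in
its own horoball. -/
theorem exists_cuspFamily [ProperSpace X] {α : ℝ} (hα : FourPoint X α)
    (hX : IsBusemannRegularHyperbolic X)
    {Γ : Subgroup (X ≃ᵢ X)} {o : X} {H : Boundary X → Set X} (hH : IsHoroballPacking Γ H)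
    (hne : ∀ p ∈ parabolicPoints Γ, ∃ q ∈ parabolicPoints Γ, q ≠ p) :
    ∃ c : Boundary X → ℝ, IsCuspFamily Γ o c ∧
      ∀ p ∈ parabolicPoints Γ, H p = {y | busemann p y o < c p} := by
  have : ∀ p, ∃ c : ℝ, p ∈ parabolicPoints Γ → H p = {y | busemann p y o < c} := by
    intro p
    by_cases hp : p ∈ parabolicPoints Γ
    · obtain ⟨x, c, hc⟩ := hH.isHoroball p hp
      refine ⟨c + busemann p x o, fun _ => ?_⟩
      rw [hc]
      ext y
      have := busemann_add hX p y x o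
      simp only [Set.mem_ofPred_eq]
      constructor <;> intro _ <;> linarith
    · exact ⟨0, fun h => absurd h hp⟩
  choose c hc using this
  have hray : ∀ p, ∀ x (t : ℝ≥0), ∃ y, busemann p y o = busemann p x o - t := by
    intro p x t
    obtain ⟨γ, rfl, rfl⟩ := exists_ray_from hα hX x p
    refine ⟨γ.1 t, ?_⟩
    rw [← busemann_add hX _ (γ.1 t) (γ.1 0) o, busemann_ray hX]
    simp
    ring
  have hnonempty : ∀ p ∈ parabolicPoints Γ, (H p).Nonempty := by
    intro p hp
    obtain ⟨y, hy⟩ := hray p o (1 - c p).toNNReal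
    refine ⟨y, ?_⟩
    rw [hc p hp, Set.mem_ofPred_eq, hy, busemann_self hX]
    linarith [Real.le_coe_toNNReal (1 - c p)]
  have hcompl : ∀ p ∈ parabolicPoints Γ, ∃ x, c p ≤ busemann p x o := by
    intro p hp
    obtain ⟨q, hq, hqp⟩ := hne p hp
    obtain ⟨x, hx⟩ := hnonempty q hq
    refine ⟨x, not_lt.1 fun hlt => ?_⟩
    have : x ∈ H p := by rw [hc p hp]; exact hlt
    exact Set.disjoint_left.1 (hH.disjoint q hq p hp hqp) hx this
  have huniq : ∀ p ∈ parabolicPoints Γ, ∀ d : ℝ, H p = {y | busemann p y o < d} → c p = d := by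
    intro p hp d hd
    obtain ⟨x, hx⟩ := hcompl p hp
    have hx' : d ≤ busemann p x o := by
      by_contra! hlt
      have : x ∈ H p := by rw [hd]; exact hlt
      rw [hc p hp] at this
      exact absurd this (not_lt.2 hx)
    rw [hc p hp] at hd
    have key : ∀ a b : ℝ, a ≤ busemann p x o → {y | busemann p y o < a} = {y | busemann p y o < b} →
        b ≤ a := by
      intro a b ha hab
      obtain ⟨y, hy⟩ := hray p x (busemann p x o - a).toNNReal
      rw [Real.coe_toNNReal _ (by linarith)] at hy
      have : y ∉ {y | busemann p y o < a} := by
        rw [Set.mem_ofPred_eq, hy]; linarith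
      rw [hab, Set.mem_ofPred_eq, hy] at this
      linarith
    exact le_antisymm (key d _ hx' hd.symm) (key _ d hx hd)
  refine ⟨c, ⟨fun g hg p hp => ?_, fun p hp q hq hpq x hx => ?_⟩, hc⟩
  · refine huniq _ (smul_mem_parabolicPoints hX hg hp) _ ?_
    rw [hH.equivariant g hg p hp, hc p hp]
    ext y
    have h1 := busemann_smul hX g p (g.symm y) o
    rw [g.apply_symm_apply] at h1
    have h2 := busemann_add hX (g • p) y (g o) o
    constructor
    · rintro ⟨z, hz, rfl⟩
      rw [g.symm_apply_apply] at h1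
      rw [Set.mem_ofPred_eq] at hz ⊢
      linarith
    · intro hy
      refine ⟨g.symm y, ?_, g.apply_symm_apply y⟩
      rw [Set.mem_ofPred_eq] at hy ⊢
      linarith
  · by_contra! hlt
    have h1 : x ∈ H p := by rw [hc p hp]; exact hx
    have h2 : x ∈ H q := by rw [hc q hq]; exact hlt
    exact Set.disjoint_left.1 (hH.disjoint p hp q hq hpq) h1 h2

theorem depth_le_add_dist (hX : IsBusemannRegularHyperbolic X) (o : X) (c : Boundary X → ℝ)
    (p : Boundary X) (x y : X) : depth o c p x ≤ depth o c p y + dist x y := by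
  have h1 := busemann_add hX p x y o
  have h2 := neg_dist_le_busemann hX p x y
  rw [depth, depth]; linarith

theorem IsCuspFamily.depth_smul (hX : IsBusemannRegularHyperbolic X) {Γ : Subgroup (X ≃ᵢ X)}
    {o : X} {c : Boundary X → ℝ} (hc : IsCuspFamily Γ o c) {g : X ≃ᵢ X} (hg : g ∈ Γ)
    {p : Boundary X} (hp : p ∈ parabolicPoints Γ) (x : X) :
    depth o c (g • p) (g x) = depth o c p x := by
  have h1 := busemann_add hX (g • p) (g x) (g o) o
  rw [busemann_smul hX] at h1
  rw [depth, depth, hc.equivariant g hg p hp]; linarith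

/-- By disjointness at most one horoball contains `o` at positive depth, and equivariance moves
every orbit point to `o`. -/
theorem IsCuspFamily.exists_depth_le (hX : IsBusemannRegularHyperbolic X)
    {Γ : Subgroup (X ≃ᵢ X)} {o : X} {c : Boundary X → ℝ} (hc : IsCuspFamily Γ o c) :
    ∃ b : ℝ, 0 ≤ b ∧ ∀ p ∈ parabolicPoints Γ, ∀ g ∈ Γ, depth o c p (g o) ≤ b := by
  have : ∃ b : ℝ, 0 ≤ b ∧ ∀ p ∈ parabolicPoints Γ, depth o c p o ≤ b := by
    by_cases h : ∃ q ∈ parabolicPoints Γ, 0 < depth o c q o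
    · obtain ⟨q, hq, hq0⟩ := h
      refine ⟨depth o c q o, hq0.le, fun p hp => ?_⟩
      by_cases hpq : q = p
      · rw [hpq]
      · have := hc.disjoint q hq p hp hpq o (by rw [depth] at hq0; linarith)
        have h2 : depth o c p o ≤ 0 := by rw [depth]; linarith
        exact h2.trans hq0.le
    · push Not at h
      exact ⟨0, le_rfl, h⟩
  obtain ⟨b, hb, h⟩ := this
  refine ⟨b, hb, fun p hp g hg => ?_⟩
  have h1 := h _ (smul_mem_parabolicPoints hX (inv_mem hg) hp)
  have h2 := hc.depth_smul hX hg (smul_mem_parabolicPoints hX (inv_mem hg) hp) o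
  rw [smul_inv_smul] at h2
  rwa [h2]

theorem infDist_orbit_smul {Γ : Subgroup (X ≃ᵢ X)} {g : X ≃ᵢ X} (hg : g ∈ Γ) (o x : X) :
    Metric.infDist (g x) (orbit Γ o) = Metric.infDist x (orbit Γ o) := by
  have : orbit Γ o = g '' orbit Γ o := by
    ext y
    constructor
    · rintro ⟨k, hk, rfl⟩
      exact ⟨g⁻¹ (k o), ⟨g⁻¹ * k, mul_mem (inv_mem hg) hk, rfl⟩,
        IsometryEquiv.apply_inv_self g (k o)⟩
    · rintro ⟨_, ⟨k, hk, rfl⟩, rfl⟩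
      exact ⟨g * k, mul_mem hg hk, rfl⟩
  conv_lhs => rw [this]
  exact Metric.infDist_image g.isometry

theorem orbit_nonempty (Γ : Subgroup (X ≃ᵢ X)) (o : X) : (orbit Γ o).Nonempty :=
  ⟨o, 1, one_mem Γ, rfl⟩

theorem infDist_orbit_le {Γ : Subgroup (X ≃ᵢ X)} {g : X ≃ᵢ X} (hg : g ∈ Γ) (o x : X) :
    Metric.infDist x (orbit Γ o) ≤ dist x (g o) :=
  Metric.infDist_le_dist_of_mem ⟨g, hg, rfl⟩

theorem infDist_orbit_le_dist (Γ : Subgroup (X ≃ᵢ X)) (o x : X) :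
    Metric.infDist x (orbit Γ o) ≤ dist x o :=
  infDist_orbit_le (one_mem Γ) o x

/-! ### The hull of the orbit outside the horoballs -/

/-- Translates of orbit points by the stabilizer of a bounded parabolic point `p` can be moved
away from `p`. -/
theorem IsBoundedParabolic.exists_boundaryProduct_le [ProperSpace X] {α : ℝ}
    (hα : FourPoint X α) (hX : IsBusemannRegularHyperbolic X)
    {Γ : Subgroup (X ≃ᵢ X)} {o : X} {c : Boundary X → ℝ} (hc : IsCuspFamily Γ o c)
    (hne : ∃ p ∈ limitSet Γ, ∃ q ∈ limitSet Γ, p ≠ q)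
    {p : Boundary X} (hp : IsBoundedParabolic Γ p) :
    ∃ R : ℝ, ∀ g ∈ Γ, ∃ h ∈ stab Γ p, boundaryProduct o (h (g o)) p ≤ R := by
  obtain ⟨hp, K, hK, hKΛ, hcov⟩ := hp
  obtain ⟨R, hR⟩ := exists_separated_of_isCompact hα hX o hK fun h => (hKΛ h).2 rfl
  obtain ⟨a, ha, b, hb, hab⟩ := hne
  obtain ⟨s, hs⟩ := exists_separated hα hX o hab
  obtain ⟨d, hd0, hd⟩ := hc.exists_depth_le hX
  refine ⟨max R (max (s + 2 * α + 1 + d - c p) (s + 2 * α + 1 + d - c p + R)), fun g hg => ?_⟩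
  -- Of the two limit points g • a and g • b, at least one is separated from p as seen from g o.
  -- Cocompactness then moves it into K, where it is separated from p as seen from `o` too.
  have : ∃ η ∈ limitSet Γ, Separated (g o) η p (s + 2 * α + 1) := by
    rcases hα.separated_or hX (hs.smul hX g) p with h | h
    · exact ⟨_, smul_mem_limitSet hX hg ha, h⟩
    · exact ⟨_, smul_mem_limitSet hX hg hb, h⟩
  obtain ⟨η, hη, hsep⟩ := this
  obtain ⟨h, hh, η', hη', rfl⟩ := hcov η ⟨hη, hsep.ne hX⟩
  refine ⟨h⁻¹, inv_mem hh, ?_⟩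
  have hfix : h⁻¹ • p = p := (inv_mem hh : h⁻¹ ∈ stab Γ p).2
  have hsep' := hsep.smul hX h⁻¹
  rw [inv_smul_smul, hfix] at hsep'
  set w := h⁻¹ (g o)
  have hw : depth o c p w ≤ d := hd p hp (h⁻¹ * g) (mul_mem (inv_mem hh.1) hg)
  have h1 := hR η' hη' w
  have h2 := hsep' o
  have h3 := boundaryProduct_add_swap hX o w p
  have h4 := boundaryProduct_add_swap hX o w η'
  have h5 := boundaryProduct_nonneg hX o w p
  have h6 : boundaryProduct o w p = (dist w o - busemann p w o) / 2 := rfl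
  rw [depth] at hw
  rw [le_max_iff, le_max_iff]
  -- If w is not already away from p, it lies off the direction of η' seen from `o`. Then either
  -- d(o, w) is bounded, or the product at w is; in both cases the depth bound on orbit points
  -- controls β_p(w, o) from below.
  rcases min_le_iff.1 h1 with h1 | h1
  · rcases min_le_iff.1 h2 with h2 | h2
    · exact Or.inr (Or.inr (by linarith))
    · exact Or.inr (Or.inl (by linarith))
  · exact Or.inl h1

/-- If `o` and `y` are both close to the geodesic from `w` to `ξ`, then their distance is
essentially given by the Busemann function at `ξ`. -/
theorem FourPoint.dist_le_abs_busemann {α : ℝ} (hα : FourPoint X α)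
    (hX : IsBusemannRegularHyperbolic X) {o y w : X} {ξ : Boundary X} {r : ℝ}
    (ho : boundaryProduct o w ξ ≤ r) (hy : boundaryProduct y w ξ ≤ r) :
    dist o y ≤ |busemann ξ y o| + 2 * r + 2 * α := by
  have h1 := hα.dist_add_busemann_le hX o o y w ξ
  have h2 := busemann_add hX ξ w y o
  rw [busemann_self hX, add_zero] at h1
  rw [boundaryProduct, dist_comm] at ho hy
  have h3 := le_abs_self (busemann ξ y o)
  have h4 := neg_abs_le (busemann ξ y o)
  rcases le_max_iff.1 (sub_le_iff_le_add.2 h1) with h1 | h1 <;> linarith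

/-- Away from the horoballs, the hull of an orbit is close to the orbit. -/
theorem IsGeometricallyFinite.exists_infDist_le [ProperSpace X] {α : ℝ}
    (hα : FourPoint X α) (hX : IsBusemannRegularHyperbolic X)
    {Γ : Subgroup (X ≃ᵢ X)} (hΓ : IsGeometricallyFinite Γ) {o : X} {c : Boundary X → ℝ}
    (hc : IsCuspFamily Γ o c) (hne : ∃ p ∈ limitSet Γ, ∃ q ∈ limitSet Γ, p ≠ q) :
    ∃ D : ℝ, ∀ x, (∃ a ∈ Γ, ∃ b ∈ Γ, gromovProduct x (a o) (b o) ≤ α) →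
      Metric.infDist x (orbit Γ o) ≤ D ∨
        ∃ p ∈ parabolicPoints Γ, Metric.infDist x (orbit Γ o) - D ≤ depth o c p x := by
  by_contra! hcon
  -- A bad point is translated so that `o` is, up to 1, its nearest orbit point. The translates z n
  -- subconverge to a boundary point ζ.
  have key : ∀ n : ℕ, ∃ z, (∃ a ∈ Γ, ∃ b ∈ Γ, gromovProduct z (a o) (b o) ≤ α) ∧
      dist z o < Metric.infDist z (orbit Γ o) + 1 ∧ n < Metric.infDist z (orbit Γ o) ∧
      ∀ p ∈ parabolicPoints Γ, depth o c p z < Metric.infDist z (orbit Γ o) - n := by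
    intro n
    obtain ⟨x, ⟨a, ha, b, hb, hab⟩, hD, hdepth⟩ := hcon n
    obtain ⟨_, ⟨g, hg, rfl⟩, hgx⟩ := (Metric.infDist_lt_iff (orbit_nonempty Γ o)).1
      (lt_add_one (Metric.infDist x (orbit Γ o)))
    have hinf := infDist_orbit_smul (inv_mem hg) o x
    refine ⟨g⁻¹ x, ⟨g⁻¹ * a, mul_mem (inv_mem hg) ha, g⁻¹ * b, mul_mem (inv_mem hg) hb, ?_⟩,
      ?_, ?_, fun p hp => ?_⟩
    · simpa only [gromovProduct, IsometryEquiv.mul_apply, (g⁻¹).isometry.dist_eq] using hab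
    · have : dist (g⁻¹ x) o = dist x (g o) := by
        rw [← g.isometry.dist_eq, IsometryEquiv.apply_inv_self]
      rwa [hinf, this]
    · rwa [hinf]
    · have h1 := hc.depth_smul hX hg hp (g⁻¹ x)
      rw [IsometryEquiv.apply_inv_self] at h1
      rw [hinf, ← h1]
      exact hdepth _ (smul_mem_parabolicPoints hX hg hp)
  choose z hhull hnear hfar hdepth using key
  have hdist : ∀ n : ℕ, (n : ℝ) ≤ dist o (z n) := fun n => by
    have := infDist_orbit_le_dist Γ o (z n)
    rw [dist_comm] at this
    exact (hfar n).le.trans this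
  set U : Ultrafilter ℕ := hyperfilter ℕ
  have hU : Tendsto (fun n : ℕ => (n : ℝ)) U atTop :=
    tendsto_natCast_atTop_atTop.mono_left Nat.hyperfilter_le_atTop
  obtain ⟨γ, -, hz⟩ := exists_tendsto_endpoint hα hX U o (y := z) (tendsto_atTop_mono hdist hU)
  set ζ := endpoint γ
  have hzprod := (tendsto_toBoundary_iff hX o).1 hz
  have hζ : ζ ∈ limitSet Γ := by
    rw [mem_limitSet_iff hX o]
    intro R
    obtain ⟨n, hn1, hn2⟩ := ((hU.eventually_ge_atTop (R + 3 * α)).and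
      (hzprod.eventually_ge_atTop (R + α))).exists
    obtain ⟨a, ha, b, hb, hab⟩ := hhull n
    -- A point close to a segment [a o, b o] is close to [o, a o] or [o, b o]. The endpoint w o
    -- found this way is far out towards ζ along with z n, so ζ is a limit point.
    have : ∃ w ∈ Γ, gromovProduct (z n) o (w o) ≤ 2 * α := by
      have := hα.2 (z n) (a o) (b o) o
      rcases min_le_iff.1 ((sub_le_iff_le_add.1 this).trans (add_le_add_left hab α)) with h | h
      · rw [gromovProduct_comm] at h
        exact ⟨a, ha, by linarith⟩
      · exact ⟨b, hb, by linarith⟩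
    obtain ⟨w, hw, hwz⟩ := this
    refine ⟨w, hw, ?_⟩
    have h1 := hα.boundaryProduct_ge hX o (w o) (z n) ζ
    have h2 := gromovProduct_add_swap o (z n) (w o)
    have h3 := hdist n
    rw [gromovProduct_comm o (z n)] at h2
    rw [dist_comm] at h3
    have h4 : R + α ≤ min (gromovProduct o (w o) (z n)) (boundaryProduct o (z n) ζ) :=
      le_min (by linarith) hn2
    linarith
  rcases hΓ.conical_or_bounded ζ hζ with hcon | hpar
  -- In the conical case some g o is closer to ζ than `o` by 2, whereas no orbit point is closer to
  -- z n than `o` by more than 1.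
  · obtain ⟨g, hg, hgb⟩ := hcon.exists_busemann_le hX o (-2)
    have h1 : -1 ≤ busemann ζ (g o) o := by
      refine ge_of_tendsto ((tendsto_busemann hX ζ (g o) o).comp hz)
        (Eventually.of_forall fun n => ?_)
      have h2 := infDist_orbit_le hg o (z n)
      have h3 := hnear n
      simp only [Function.comp, dist_comm _ (z n)]
      linarith
    linarith
  · obtain ⟨R, hR⟩ := hpar.exists_boundaryProduct_le hα hX hc hne
    have hp := hpar.1
    set E := 2 * max R (2 * α) + 2 * α
    -- z n is close to a ray from an orbit point w o to ζ. A stabilizer element h moves w o so that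
    -- `o` is close to that ray as well; then d(o, h z n) is roughly |β_ζ(z n, o)|, since h
    -- preserves the horofunction.
    have hmain : ∀ n, Metric.infDist (z n) (orbit Γ o) ≤ |busemann ζ (z n) o| + E := by
      intro n
      obtain ⟨a, ha, b, hb, hab⟩ := hhull n
      have : ∃ w ∈ Γ, boundaryProduct (z n) (w o) ζ ≤ 2 * α := by
        have := hα.gromovProduct_ge hX (z n) (a o) (b o) ζ
        rcases min_le_iff.1 ((sub_le_iff_le_add.1 this).trans (add_le_add_left hab α)) with h | h
        · exact ⟨a, ha, by linarith⟩
        · exact ⟨b, hb, by linarith⟩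
      obtain ⟨w, hw, hwz⟩ := this
      obtain ⟨h, hh, hhw⟩ := hR w hw
      have h1 := hα.dist_le_abs_busemann hX (y := h (z n)) (hhw.trans (le_max_left R (2 * α)))
        (by rw [boundaryProduct_stab hX hh]; exact hwz.trans (le_max_right _ _))
      rw [← busemann_add hX ζ (h (z n)) (z n) o, busemann_stab hX hp hh, zero_add,
        dist_comm] at h1
      have h2 := infDist_orbit_le_dist Γ o (h (z n))
      rw [infDist_orbit_smul hh.1] at h2
      simp only [E]
      linarith
    -- If β_ζ(z n, o) ≥ 0, then `hmain` contradicts the growth of the product with ζ. If it is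
    -- negative, then z n is deep in the horoball at ζ, against `hdepth`.
    obtain ⟨n, hn1, hn2⟩ := ((hU.eventually_ge_atTop (E - c ζ)).and
      (hzprod.eventually_ge_atTop (E + 1))).exists
    have h1 := hmain n
    have h2 := hnear n
    have h3 := hdepth n ζ hp
    have h4 : 0 < E := by
      have := le_max_right R (2 * α)
      have := hα.1
      simp only [E]
      linarith
    rw [depth] at h3
    rw [boundaryProduct] at hn2
    rcases abs_cases (busemann ζ (z n) o) with ⟨h, -⟩ | ⟨h, -⟩ <;> rw [h] at h1 <;> linarith

/-- Supplies the hull hypothesis of `IsGeometricallyFinite.exists_infDist_le`: an orbit point far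
out towards the endpoint has a segment from `o` passing near γ t. -/
theorem exists_gromovProduct_le_of_ray {α : ℝ} (hα : FourPoint X α)
    (hX : IsBusemannRegularHyperbolic X) {Γ : Subgroup (X ≃ᵢ X)} {o : X} {γ : GeodesicRay X}
    (h0 : γ.1 0 = o) (hγ : endpoint γ ∈ limitSet Γ) (t : ℝ≥0) :
    ∃ a ∈ Γ, ∃ b ∈ Γ, gromovProduct (γ.1 t) (a o) (b o) ≤ α := by
  obtain ⟨w, hw, hwt⟩ := (mem_limitSet_iff hX o).1 hγ t
  refine ⟨1, one_mem Γ, w, hw, ?_⟩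
  change gromovProduct (γ.1 t) o (w o) ≤ α
  have h1 := boundaryProduct_ray hX γ t
  have h2 := dist_ray_zero γ t
  rw [h0] at h1 h2
  have h3 := hα.gromovProduct_ge hX o (γ.1 t) (w o) (endpoint γ)
  rw [h1, min_eq_left hwt] at h3
  have h4 := gromovProduct_add_swap o (γ.1 t) (w o)
  linarith

/-! ### Critical exponents -/

theorem criticalExponent_nonneg (G : Subgroup (X ≃ᵢ X)) (o : X) : 0 ≤ criticalExponent G o := by
  refine le_limsup_of_frequently_le (Eventually.frequently ?_)
  filter_upwards [eventually_ge_atTop 0] with t ht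
  exact_mod_cast div_nonneg (Real.log_natCast_nonneg _) ht

theorem criticalExponent_toReal_nonneg (G : Subgroup (X ≃ᵢ X)) (o : X) :
    0 ≤ (criticalExponent G o).toReal :=
  EReal.toReal_nonneg (criticalExponent_nonneg G o)

theorem criticalExponent_toReal_le {G : Subgroup (X ≃ᵢ X)} {o : X} {κ : ℝ}
    (h : criticalExponent G o ≤ κ) : (criticalExponent G o).toReal ≤ κ := by
  have := EReal.toReal_le_toReal h
    (ne_of_gt ((EReal.bot_lt_zero).trans_le (criticalExponent_nonneg G o))) (EReal.coe_ne_top κ)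
  simpa using this

/-- The critical exponents of the stabilizers are bounded along an orbit of parabolic points. -/
theorem exists_criticalExponent_smul_le {Γ : Subgroup (X ≃ᵢ X)} (hΓ : IsDiscrete Γ) (o : X)
    {p : Boundary X} {δ : ℝ} (h : criticalExponent (stab Γ p) o < δ) :
    ∃ κ < δ, ∀ g ∈ Γ, (criticalExponent (stab Γ (g • p)) o).toReal ≤ κ := by
  obtain ⟨κ, hκ, hκδ⟩ := EReal.lt_iff_exists_real_btwn.1 h
  rw [EReal.coe_lt_coe_iff] at hκδ
  have hκ0 : 0 ≤ κ := by
    have := (criticalExponent_nonneg (stab Γ p) o).trans hκ.le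
    exact_mod_cast this
  refine ⟨(κ + δ) / 2, by linarith, fun g hg => criticalExponent_toReal_le ?_⟩
  set a := dist o (g o)
  have hcount : ∀ t, {k | k ∈ stab Γ (g • p) ∧ dist o (k o) ≤ t}.ncard ≤
      {k | k ∈ stab Γ p ∧ dist o (k o) ≤ t + 2 * a}.ncard := by
    intro t
    refine Set.ncard_le_ncard_of_injOn (fun k => g⁻¹ * k * g) ?_ ?_
      ((hΓ o (t + 2 * a)).subset fun k hk => ⟨hk.1.1, hk.2⟩)
    · intro k hk
      have h1 := conj_mem_stab (Γ.inv_mem hg) hk.1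
      rw [inv_smul_smul, inv_inv] at h1
      refine ⟨h1, ?_⟩
      have h2 : dist o ((g⁻¹ * k * g) o) = dist (g o) (k (g o)) := by
        rw [← g.isometry.dist_eq]
        simp [IsometryEquiv.mul_apply, IsometryEquiv.apply_inv_self]
      have h3 := dist_triangle4 (g o) o (k o) (k (g o))
      rw [k.isometry.dist_eq, dist_comm (g o) o] at h3
      rw [h2]
      linarith [hk.2]
    · intro k _ l _ hkl
      exact mul_left_cancel (mul_right_cancel hkl)
  have hev := eventually_lt_of_limsup_lt hκ
  have hshift : Tendsto (fun t : ℝ => t + 2 * a) atTop atTop :=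
    tendsto_atTop_add_const_right _ _ tendsto_id
  refine limsup_le_of_le (h := ?_)
  -- Conjugation by g enlarges displacements by at most 2a. The last threshold ensures κ (t + 2a) ≤
  -- ((κ + δ)/2) t, which absorbs this shift.
  filter_upwards [hshift.eventually hev, eventually_gt_atTop 0,
    eventually_ge_atTop (2 * a * κ / ((δ - κ) / 2))] with t ht ht0 hta
  rw [EReal.coe_lt_coe_iff] at ht
  rw [EReal.coe_le_coe_iff, div_le_iff₀ ht0]
  have ha : 0 ≤ a := dist_nonneg
  rw [div_lt_iff₀ (by linarith)] at ht
  rw [div_le_iff₀ (by linarith)] at hta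
  have hlog : Real.log ({k | k ∈ stab Γ (g • p) ∧ dist o (k o) ≤ t}.ncard) ≤
      Real.log ({k | k ∈ stab Γ p ∧ dist o (k o) ≤ t + 2 * a}.ncard) := by
    rcases Nat.eq_zero_or_pos {k | k ∈ stab Γ (g • p) ∧ dist o (k o) ≤ t}.ncard with h0 | h0
    · rw [h0, Nat.cast_zero, Real.log_zero]
      exact Real.log_natCast_nonneg _
    · exact Real.log_le_log (by exact_mod_cast h0) (by exact_mod_cast hcount t)
  nlinarith

/-! ### First consequences of the shadow lemma -/

theorem exp_shadow_le {δ k d t : ℝ} (hk : k ∈ Set.Icc 0 δ) (hd : 0 ≤ d) :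
    -δ * t + (2 * k - δ) * d ≤ -δ * t + δ * d := by
  have := mul_nonneg (sub_nonneg.2 hk.2) hd
  linarith

section Measure

variable {Γ : Subgroup (X ≃ᵢ X)} {o : X} {H : Boundary X → Set X} {δ : ℝ}
  {ν : Measure (Boundary X)}

/-- The exponent `k` in the shadow lemma lies in `[0, δ)`. -/
theorem exponent_mem {p : Boundary X} (h : criticalExponent (stab Γ p) o < δ) :
    (criticalExponent (stab Γ p) o).toReal ∈ Set.Ico 0 δ := by
  refine ⟨criticalExponent_toReal_nonneg _ _, ?_⟩
  obtain ⟨κ, hκ, hκδ⟩ := EReal.lt_iff_exists_real_btwn.1 h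
  exact (criticalExponent_toReal_le hκ.le).trans_lt (EReal.coe_lt_coe_iff.1 hκδ)

theorem measureReal_eq_univ_of_limitSet_subset [IsFiniteMeasure ν] (hν : ν (limitSet Γ)ᶜ = 0)
    {s : Set (Boundary X)} (hs : limitSet Γ ⊆ s) : ν.real s = ν.real Set.univ := by
  refine le_antisymm (measureReal_mono (Set.subset_univ _)) ?_
  have h1 : ν.real sᶜ = 0 := by
    rw [measureReal_def, measure_mono_null (Set.compl_subset_compl.2 hs) hν, ENNReal.toReal_zero]
  have h2 := measureReal_union_le (μ := ν) s sᶜ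
  rw [Set.union_compl_self, h1] at h2
  linarith

theorem GlobalShadowLemma.univ_pos [ProperSpace X] {α : ℝ} (hα : FourPoint X α)
    (hX : IsBusemannRegularHyperbolic X) [IsFiniteMeasure ν]
    (hP : (parabolicPoints Γ).Nonempty) (hshadow : GlobalShadowLemma Γ o H δ ν) :
    0 < ν.real Set.univ := by
  obtain ⟨C, hC, h⟩ := hshadow
  obtain ⟨p, hp⟩ := hP
  obtain ⟨γ, h0, rfl⟩ := exists_ray_from hα hX o p
  have h1 := h γ h0 hp.1 0
  have key : ∀ k, ShadowEstimate Γ o δ ν C γ 0 k → 0 < ν.real Set.univ := fun k hk =>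
    (by positivity : 0 < C⁻¹ * Real.exp (-δ * (0 : ℝ≥0) +
      (2 * k - δ) * Metric.infDist (γ.1 0) (orbit Γ o))).trans_le
      (hk.1.trans (measureReal_mono (Set.subset_univ _)))
  by_cases hex : ∃ q ∈ parabolicPoints Γ, γ.1 0 ∈ H q
  · obtain ⟨q, hq, hqH⟩ := hex
    exact key _ (h1.1 q hq hqH)
  · push Not at hex
    exact key _ (h1.2 hex)

/-- Parabolic points are not atoms of the measure, so there is more than one of them. -/
theorem GlobalShadowLemma.exists_parabolic_ne [ProperSpace X] {α : ℝ} (hα : FourPoint X α)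
    (hX : IsBusemannRegularHyperbolic X) [IsFiniteMeasure ν] (hν : ν (limitSet Γ)ᶜ = 0)
    (hδ0 : 0 < δ) (hδ : ∀ p ∈ parabolicPoints Γ, criticalExponent (stab Γ p) o < δ)
    (hshadow : GlobalShadowLemma Γ o H δ ν) {p : Boundary X} (hp : p ∈ parabolicPoints Γ) :
    ∃ q ∈ parabolicPoints Γ, q ≠ p := by
  by_contra! hall
  have hm := hshadow.univ_pos hα hX ⟨p, hp⟩
  -- If p were the only parabolic point, all of Γ would fix it and preserve its horofunction. The
  -- orbit would stay on a horosphere at p and could accumulate only at p.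
  have hΛ : ∀ ξ ∈ limitSet Γ, ξ = p := by
    intro ξ hξ
    refine boundary_eq_of_frequently hα hX (o := o) fun R => ?_
    obtain ⟨g, hg, hgR⟩ := (mem_limitSet_iff hX o).1 hξ (max R (2 * R))
    refine ⟨g o, (le_max_left _ _).trans hgR, ?_⟩
    have h1 : g ∈ stab Γ p := ⟨hg, hall _ (smul_mem_parabolicPoints hX hg hp)⟩
    have h2 := boundaryProduct_le_dist hX o (g o) ξ
    rw [boundaryProduct, busemann_stab hX hp h1]
    linarith [(le_max_right _ _).trans hgR]
  obtain ⟨γ, h0, rfl⟩ := exists_ray_from hα hX o p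
  obtain ⟨C, hC, h⟩ := hshadow
  obtain ⟨hk0, hkδ⟩ := exponent_mem (hδ _ hp)
  set k := (criticalExponent (stab Γ (endpoint γ)) o).toReal
  have key : ∀ t : ℝ≥0, ν.real Set.univ ≤ C * Real.exp (-(min δ (2 * (δ - k)) * t)) := by
    intro t
    have h1 := h γ h0 hp.1 t
    rw [← measureReal_eq_univ_of_limitSet_subset hν (s := shadow γ t) fun ξ hξ =>
      hΛ ξ hξ ▸ endpoint_mem_shadow hX γ t]
    have hd := infDist_orbit_le_dist Γ o (γ.1 t)
    rw [← h0, dist_ray_zero, h0] at hd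
    have hd0 : 0 ≤ Metric.infDist (γ.1 t) (orbit Γ o) := Metric.infDist_nonneg
    -- Since d(ξ_t, Γ o) ≤ t, the exponent is at most −δ t when 2k' ≤ δ and at most −2(δ − k') t
    -- otherwise. So the shadows, all of full mass, would have mass tending to 0.
    have main : ∀ k', 0 ≤ k' → k' ≤ k → -δ * t + (2 * k' - δ) * Metric.infDist (γ.1 t) (orbit Γ o)
        ≤ -(min δ (2 * (δ - k)) * t) := by
      intro k' hk'0 hk'
      have ht : (0 : ℝ) ≤ t := t.2
      rcases le_total (2 * k' - δ) 0 with hs | hs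
      · have := mul_le_mul_of_nonneg_right (min_le_left δ (2 * (δ - k))) ht
        have := mul_nonneg (neg_nonneg.2 hs) hd0
        linarith
      · have := mul_le_mul_of_nonneg_right (min_le_right δ (2 * (δ - k))) ht
        have := mul_le_mul_of_nonneg_left hd hs
        have := mul_le_mul_of_nonneg_right hk' ht
        linarith
    by_cases hex : γ.1 t ∈ H (endpoint γ)
    · exact (h1.1 _ hp hex).2.trans (mul_le_mul_of_nonneg_left
        (Real.exp_le_exp.2 (main k hk0 le_rfl)) hC.le)
    · exact (h1.2 fun q hq => hall q hq ▸ hex).2.trans (mul_le_mul_of_nonneg_left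
        (Real.exp_le_exp.2 (main 0 le_rfl hk0)) hC.le)
  have hlim : Tendsto (fun t : ℝ≥0 => C * Real.exp (-(min δ (2 * (δ - k)) * t))) atTop (𝓝 0) := by
    rw [← mul_zero C]
    refine (Real.tendsto_exp_neg_atTop_nhds_zero.comp ?_).const_mul C
    exact (NNReal.tendsto_coe_atTop.2 tendsto_id).const_mul_atTop
      (lt_min hδ0 (by linarith))
  exact absurd (ge_of_tendsto' hlim key) (not_le.2 hm)

/-- A bound that does not see k; nothing is lost where the distance to the orbit is bounded. -/
theorem GlobalShadowLemma.exists_le (hδ0 : 0 < δ)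
    (hδ : ∀ p ∈ parabolicPoints Γ, criticalExponent (stab Γ p) o < δ)
    (hshadow : GlobalShadowLemma Γ o H δ ν) :
    ∃ C : ℝ, 0 < C ∧ ∀ γ : GeodesicRay X, γ.1 0 = o → endpoint γ ∈ limitSet Γ → ∀ t : ℝ≥0,
      ν.real (shadow γ t) ≤
        C * Real.exp (-δ * t + δ * Metric.infDist (γ.1 t) (orbit Γ o)) := by
  obtain ⟨C, hC, h⟩ := hshadow
  refine ⟨C, hC, fun γ h0 hγ t => ?_⟩
  have key : ∀ k ∈ Set.Icc 0 δ, ShadowEstimate Γ o δ ν C γ t k → ν.real (shadow γ t) ≤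
      C * Real.exp (-δ * t + δ * Metric.infDist (γ.1 t) (orbit Γ o)) := fun k hk hs =>
    hs.2.trans (mul_le_mul_of_nonneg_left (Real.exp_le_exp.2
      (exp_shadow_le hk Metric.infDist_nonneg)) hC.le)
  by_cases hex : ∃ q ∈ parabolicPoints Γ, γ.1 t ∈ H q
  · obtain ⟨q, hq, hqH⟩ := hex
    exact key _ (Set.Ico_subset_Icc_self (exponent_mem (hδ q hq))) ((h γ h0 hγ t).1 q hq hqH)
  · push Not at hex
    exact key _ ⟨le_rfl, hδ0.le⟩ ((h γ h0 hγ t).2 hex)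

end Measure

/-! ### Excursions into the horoballs -/

/-- The time at which a ray from `o` to `p` enters the horoball at `p`. -/
def entryTime (c : Boundary X → ℝ) (p : Boundary X) : ℝ≥0 := (-c p).toNNReal

theorem neg_le_entryTime (c : Boundary X → ℝ) (p : Boundary X) : -c p ≤ entryTime c p :=
  Real.le_coe_toNNReal _

theorem depth_basepoint (hX : IsBusemannRegularHyperbolic X) (o : X) (c : Boundary X → ℝ)
    (p : Boundary X) : depth o c p o = c p := by
  rw [depth, busemann_self hX, sub_zero]

theorem depth_ray (hX : IsBusemannRegularHyperbolic X) (c : Boundary X → ℝ) {o : X}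
    {γ : GeodesicRay X} (h0 : γ.1 0 = o) (t : ℝ≥0) :
    depth o c (endpoint γ) (γ.1 t) = c (endpoint γ) + t := by
  rw [depth, ← h0, busemann_ray hX]; simp

theorem entryTime_le (c : Boundary X → ℝ) (p : Boundary X) {b : ℝ} (hb : 0 ≤ b) (h : c p ≤ b) :
    entryTime c p + c p ≤ b := by
  rw [entryTime, Real.coe_toNNReal']
  rcases max_cases (-c p) 0 with ⟨h1, -⟩ | ⟨h1, -⟩ <;> rw [h1] <;> linarith

/-- The distance to the orbit grows linearly along a ray to a parabolic point, once it has
entered the horoball. -/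
theorem IsGeometricallyFinite.exists_infDist_ray [ProperSpace X] {α : ℝ}
    (hα : FourPoint X α) (hX : IsBusemannRegularHyperbolic X)
    {Γ : Subgroup (X ≃ᵢ X)} (hΓ : IsGeometricallyFinite Γ) {o : X} {c : Boundary X → ℝ}
    (hc : IsCuspFamily Γ o c) (hne : ∃ p ∈ limitSet Γ, ∃ q ∈ limitSet Γ, p ≠ q) :
    ∃ D : ℝ, 0 ≤ D ∧ ∀ γ : GeodesicRay X, γ.1 0 = o → endpoint γ ∈ parabolicPoints Γ →
      ∀ u : ℝ≥0, entryTime c (endpoint γ) ≤ u →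
        |Metric.infDist (γ.1 u) (orbit Γ o) - (u - entryTime c (endpoint γ))| ≤ D := by
  obtain ⟨D, hD⟩ := hΓ.exists_infDist_le hα hX hc hne
  obtain ⟨b, hb0, hb⟩ := hc.exists_depth_le hX
  refine ⟨max (D + b + 2) b, hb0.trans (le_max_right _ _), fun γ h0 hp u hu => ?_⟩
  have hu' : (entryTime c (endpoint γ) : ℝ) ≤ u := hu
  set p := endpoint γ
  have hcb : entryTime c p + c p ≤ b := entryTime_le c p hb0 (by
    have := hb p hp 1 (one_mem Γ)
    rwa [← depth_basepoint hX o c p])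
  have hτ := neg_le_entryTime c p
  -- One unit after entry the point is strictly inside H_p, so its depth in every other horoball is
  -- at most 0, and its depth in H_p is at most b + 1.
  have hD0 : Metric.infDist (γ.1 (entryTime c p + 1)) (orbit Γ o) ≤ D + b + 1 := by
    have hdep := depth_ray hX c h0 (entryTime c p + 1)
    push_cast at hdep
    rcases hD _ (exists_gromovProduct_le_of_ray hα hX h0 hp.1 (entryTime c p + 1)) with h | h
    · linarith
    · obtain ⟨q, hq, h⟩ := h
      by_cases hpq : p = q
      · rw [← hpq, hdep] at h
        linarith
      · have := hc.disjoint p hp q hq hpq (γ.1 (entryTime c p + 1))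
          (by rw [depth] at hdep; linarith)
        rw [depth] at h
        linarith
  have h1 := Metric.infDist_le_infDist_add_dist (s := orbit Γ o) (x := γ.1 u)
    (y := γ.1 (entryTime c p + 1))
  rw [dist_ray] at h1
  push_cast at h1
  have h2 : |(u : ℝ) - (entryTime c p + 1)| ≤ u - entryTime c p + 1 := by
    rw [abs_le]; constructor <;> linarith
  -- Depth is 1-Lipschitz, at most b on the orbit and at least u − τ at time u.
  have h3 : u - entryTime c p - b ≤ Metric.infDist (γ.1 u) (orbit Γ o) := by
    rw [Metric.le_infDist (orbit_nonempty Γ o)]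
    rintro _ ⟨g, hg, rfl⟩
    have h4 := depth_le_add_dist hX o c p (γ.1 u) (g o)
    rw [depth_ray hX c h0] at h4
    linarith [hb p hp g hg]
  rw [abs_le]
  constructor
  · linarith [le_max_right (D + b + 2) b]
  · linarith [le_max_left (D + b + 2) b]

/-- The data of a horoball packing with a measure satisfying the global shadow lemma, with the
horoballs given as sublevel sets of Busemann functions based at `o`. -/
structure ShadowSystem (Γ : Subgroup (X ≃ᵢ X)) (o : X) (δ α : ℝ) (c : Boundary X → ℝ)
    (H : Boundary X → Set X) (ν : Measure (Boundary X)) : Prop where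
  regular : IsBusemannRegularHyperbolic X
  fourPoint : FourPoint X α
  geometricallyFinite : IsGeometricallyFinite Γ
  cusps : IsCuspFamily Γ o c
  level : ∀ p ∈ parabolicPoints Γ, H p = {y | busemann p y o < c p}
  nonempty : (parabolicPoints Γ).Nonempty
  exists_ne : ∀ p ∈ parabolicPoints Γ, ∃ q ∈ parabolicPoints Γ, q ≠ p
  pos : 0 < δ
  critical : ∀ p ∈ parabolicPoints Γ, criticalExponent (stab Γ p) o < δ
  finite : IsFiniteMeasure ν
  support : ν (limitSet Γ)ᶜ = 0
  shadowLemma : GlobalShadowLemma Γ o H δ ν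

namespace ShadowSystem

variable {Γ : Subgroup (X ≃ᵢ X)} {o : X} {δ α : ℝ} {c : Boundary X → ℝ}
    {H : Boundary X → Set X} {ν : Measure (Boundary X)}

theorem exists_limit_ne (S : ShadowSystem Γ o δ α c H ν) :
    ∃ p ∈ limitSet Γ, ∃ q ∈ limitSet Γ, p ≠ q := by
  obtain ⟨p, hp⟩ := S.nonempty
  obtain ⟨q, hq, hqp⟩ := S.exists_ne p hp
  exact ⟨q, hq.1, p, hp.1, hqp⟩

theorem exists_level_le (S : ShadowSystem Γ o δ α c H ν) :
    ∃ b : ℝ, 0 ≤ b ∧ ∀ p ∈ parabolicPoints Γ, c p ≤ b := by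
  obtain ⟨b, hb0, hb⟩ := S.cusps.exists_depth_le S.regular
  refine ⟨b, hb0, fun p hp => ?_⟩
  have := hb p hp 1 (one_mem Γ)
  rwa [← depth_basepoint S.regular o c p]

/-- The measure of shadows centered at parabolic points. -/
theorem exists_shadow_bounds [ProperSpace X] (S : ShadowSystem Γ o δ α c H ν) :
    ∃ C : ℝ, 0 < C ∧ ∀ γ : GeodesicRay X, γ.1 0 = o → endpoint γ ∈ parabolicPoints Γ →
      ∀ u : ℝ≥0, entryTime c (endpoint γ) < u → ∀ k,
        k = (criticalExponent (stab Γ (endpoint γ)) o).toReal →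
        C⁻¹ * Real.exp (-δ * entryTime c (endpoint γ) -
          2 * (δ - k) * (u - entryTime c (endpoint γ))) ≤ ν.real (shadow γ u) ∧
        ν.real (shadow γ u) ≤ C * Real.exp (-δ * entryTime c (endpoint γ) -
          2 * (δ - k) * (u - entryTime c (endpoint γ))) := by
  obtain ⟨C, hC, h⟩ := S.shadowLemma
  obtain ⟨D, hD0, hD⟩ := S.geometricallyFinite.exists_infDist_ray S.fourPoint S.regular S.cusps
    S.exists_limit_ne
  refine ⟨C * Real.exp (δ * D), by positivity, fun γ h0 hp u hu k hk => ?_⟩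
  have hu' : (entryTime c (endpoint γ) : ℝ) < u := hu
  have hmem : γ.1 u ∈ H (endpoint γ) := by
    rw [S.level _ hp, Set.mem_ofPred_eq]
    have h1 := depth_ray S.regular c h0 u
    have h2 := neg_le_entryTime c (endpoint γ)
    rw [depth] at h1
    linarith
  obtain ⟨h1, h2⟩ := (h γ h0 hp.1 u).1 _ hp hmem
  rw [← hk] at h1 h2
  have hk' := exponent_mem (S.critical _ hp)
  rw [← hk] at hk'
  have hd := hD γ h0 hp u hu.le
  set τ : ℝ := ((entryTime c (endpoint γ) : ℝ≥0) : ℝ)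
  set d := Metric.infDist (γ.1 u) (orbit Γ o)
  -- With d replaced by u − τ, the exponent −δu + (2k − δ)d becomes −δτ − 2(δ − k)(u − τ). The error
  -- is at most δD because |2k − δ| ≤ δ.
  have hkey : |(2 * k - δ) * (d - (u - τ))| ≤ δ * D := by
    rw [abs_mul]
    exact mul_le_mul (abs_le.2 ⟨by linarith [hk'.1], by linarith [hk'.2]⟩) hd (abs_nonneg _)
      S.pos.le
  rw [abs_le] at hkey
  constructor
  · refine le_trans ?_ h1
    rw [mul_inv, mul_assoc, ← Real.exp_neg, ← Real.exp_add]
    refine mul_le_mul_of_nonneg_left (Real.exp_le_exp.2 ?_) (inv_nonneg.2 hC.le)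
    linarith [hkey.1]
  · refine h2.trans ?_
    rw [mul_assoc, ← Real.exp_add]
    refine mul_le_mul_of_nonneg_left (Real.exp_le_exp.2 ?_) hC.le
    linarith [hkey.2]

/-- Tubes around the rays to distinct parabolic points are disjoint inside the horoballs. -/
theorem disjoint_tube (S : ShadowSystem Γ o δ α c H ν) {γ γ' : GeodesicRay X}
    (h0 : γ.1 0 = o) (h0' : γ'.1 0 = o) (hp : endpoint γ ∈ parabolicPoints Γ)
    (hp' : endpoint γ' ∈ parabolicPoints Γ) (hne : endpoint γ ≠ endpoint γ') {R : ℝ≥0}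
    (hR : entryTime c (endpoint γ) < (R : ℝ))
    (hR' : entryTime c (endpoint γ') + 14 * α < (R : ℝ)) :
    Disjoint (tube α γ R) (tube α γ' R) := by
  rw [Set.disjoint_left]
  rintro η ⟨ρ, hρ0, hρ, hρR⟩ ⟨ρ', hρ0', hρ', hρR'⟩
  -- A common point η puts γ R and γ' R within 6α + 2α + 6α = 14α. But γ R, inside the first
  -- horoball, has depth at most 0 in the second, where γ' R has depth greater than 14α.
  have h1 := S.fourPoint.dist_asymptotic S.regular (hρ.trans hρ'.symm) R
  rw [hρ0, hρ0', h0, h0', dist_self, mul_zero, zero_add] at h1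
  have h2 := dist_triangle4 (γ.1 R) (ρ.1 R) (ρ'.1 R) (γ'.1 R)
  rw [dist_comm (γ.1 R) (ρ.1 R)] at h2
  have h3 := depth_ray S.regular c h0 R
  have h4 := depth_ray S.regular c h0' R
  have h5 := depth_le_add_dist S.regular o c (endpoint γ') (γ'.1 R) (γ.1 R)
  rw [dist_comm] at h5
  have h6 := neg_le_entryTime c (endpoint γ)
  have h7 := neg_le_entryTime c (endpoint γ')
  have h8 := S.cusps.disjoint _ hp _ hp' hne (γ.1 R) (by rw [depth] at h3; linarith)
  rw [h4, depth] at h5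
  linarith

/-! ### Upper bound on the number of horoballs -/

/-- The parabolic points whose horoball is at distance between `j` and `j + 1` from `o`. -/
def layer (Γ : Subgroup (X ≃ᵢ X)) (c : Boundary X → ℝ) (j : ℕ) : Set (Boundary X) :=
  {p | p ∈ parabolicPoints Γ ∧ (j : ℝ) ≤ entryTime c p ∧ (entryTime c p : ℝ) ≤ j + 1}

/-- A packing argument: disjoint tubes, each containing a shadow of mass at least a constant times
e^{−δj}. It is stated for finite subsets since finiteness of the layer is only a consequence. -/
theorem exists_card_layer_le [ProperSpace X] (S : ShadowSystem Γ o δ α c H ν) :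
    ∃ C : ℝ, 0 < C ∧ ∀ (j : ℕ) (F : Finset (Boundary X)), ↑F ⊆ layer Γ c j →
      (F.card : ℝ) ≤ C * Real.exp (δ * j) := by
  have := S.finite
  obtain ⟨C, hC, hsh⟩ := S.exists_shadow_bounds
  choose γ h0 hγ using exists_ray_from S.fourPoint S.regular o
  have hα := S.fourPoint.1
  have hδ := S.pos
  set m := ν.real Set.univ
  have hm : 0 < m := S.shadowLemma.univ_pos S.fourPoint S.regular S.nonempty
  refine ⟨C * m * Real.exp (δ * (5 + 32 * α)), by positivity, fun j F hF => ?_⟩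
  -- Entry times are at most j + 1, so R satisfies `disjoint_tube`. The time u = R + 2α then puts
  -- the shadow inside the tube.
  set R : ℝ≥0 := (j + 2 + 14 * α : ℝ).toNNReal with hR
  have hRc : (R : ℝ) = j + 2 + 14 * α := Real.coe_toNNReal _ (by positivity)
  set u : ℝ≥0 := (j + 2 + 16 * α : ℝ).toNNReal with hu
  have huc : (u : ℝ) = j + 2 + 16 * α := Real.coe_toNNReal _ (by positivity)
  have hdisj : Set.PairwiseDisjoint (F : Set (Boundary X)) fun p => tube α (γ p) R := by
    intro p hp q hq hpq
    refine S.disjoint_tube (h0 p) (h0 q) ?_ ?_ ?_ ?_ ?_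
    · rw [hγ]; exact (hF hp).1
    · rw [hγ]; exact (hF hq).1
    · rwa [hγ, hγ]
    · rw [hγ]; linarith [(hF hp).2.2]
    · rw [hγ]; linarith [(hF hq).2.2]
  have hsum : ∑ p ∈ F, ν.real (tube α (γ p) R) ≤ m := by
    rw [← measureReal_biUnion_finset hdisj fun p _ =>
      (isClosed_tube S.fourPoint S.regular (γ p) R).measurableSet]
    exact measureReal_mono (Set.subset_univ _)
  have hlow : ∀ p ∈ F, C⁻¹ * Real.exp (-δ * j - δ * (5 + 32 * α)) ≤ ν.real (tube α (γ p) R) := by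
    intro p hp
    obtain ⟨hpP, hpj, hpj'⟩ := hF hp
    have h1 := (hsh (γ p) (h0 p) (by rwa [hγ]) u (by
      rw [hγ, ← NNReal.coe_lt_coe, huc]; linarith) _ rfl).1
    rw [hγ] at h1
    have hk := exponent_mem (S.critical p hpP)
    set k := (criticalExponent (stab Γ p) o).toReal
    have h2 : (δ - k) * (u - entryTime c p) ≤ δ * (2 + 16 * α) :=
      mul_le_mul (by linarith [hk.1]) (by linarith) (by linarith) hδ.le
    refine (mul_le_mul_of_nonneg_left (Real.exp_le_exp.2 ?_) (inv_nonneg.2 hC.le)).trans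
      (h1.trans (measureReal_mono (shadow_subset_tube S.fourPoint S.regular (γ p)
        (by linarith))))
    have h3 := mul_le_mul_of_nonneg_left hpj' hδ.le
    linarith
  have hcard := (Finset.card_nsmul_le_sum F _ _ hlow).trans hsum
  rw [nsmul_eq_mul, sub_eq_add_neg, Real.exp_add, neg_mul, Real.exp_neg, Real.exp_neg] at hcard
  have e1 := Real.exp_pos (δ * j)
  have e2 := Real.exp_pos (δ * (5 + 32 * α))
  have : (F.card : ℝ) * (C⁻¹ * ((Real.exp (δ * j))⁻¹ * (Real.exp (δ * (5 + 32 * α)))⁻¹)) =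
      F.card / (C * Real.exp (δ * (5 + 32 * α)) * Real.exp (δ * j)) := by
    field_simp
  rw [this, div_le_iff₀ (by positivity)] at hcard
  linarith

theorem finite_layer [ProperSpace X] (S : ShadowSystem Γ o δ α c H ν) (j : ℕ) :
    (layer Γ c j).Finite := by
  obtain ⟨C, -, hC⟩ := S.exists_card_layer_le
  by_contra hinf
  obtain ⟨n, hn⟩ := exists_nat_gt (C * Real.exp (δ * j))
  obtain ⟨F, hF, hFn⟩ := Set.Infinite.exists_subset_card_eq hinf n
  have := hC j F hF
  rw [hFn] at this
  linarith

theorem exists_ncard_layer_le [ProperSpace X] (S : ShadowSystem Γ o δ α c H ν) :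
    ∃ C : ℝ, 0 < C ∧ ∀ j : ℕ, ((layer Γ c j).ncard : ℝ) ≤ C * Real.exp (δ * j) := by
  obtain ⟨C, hC0, hC⟩ := S.exists_card_layer_le
  refine ⟨C, hC0, fun j => ?_⟩
  rw [Set.ncard_eq_toFinset_card _ (S.finite_layer j)]
  exact hC j _ (by simp)

theorem finite_entryTime_le [ProperSpace X] (S : ShadowSystem Γ o δ α c H ν) (M : ℝ) :
    {p | p ∈ parabolicPoints Γ ∧ (entryTime c p : ℝ) ≤ M}.Finite := by
  refine ((Finset.range (⌊M⌋₊ + 1)).finite_toSet.biUnion fun j _ => S.finite_layer j).subset ?_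
  rintro p ⟨hp, hpM⟩
  rw [Set.mem_iUnion₂]
  exact ⟨⌊(entryTime c p : ℝ)⌋₊, by
    simpa [Nat.lt_succ_iff] using Nat.floor_le_floor hpM, hp, Nat.floor_le (entryTime c p).2,
    (Nat.lt_floor_add_one _).le⟩

/-- Up to the action of `Γ` there are finitely many parabolic points, so that the critical
exponents of their stabilizers are bounded away from `δ`. -/
theorem exists_criticalExponent_le [ProperSpace X] (S : ShadowSystem Γ o δ α c H ν) :
    ∃ κ < δ, ∀ p ∈ parabolicPoints Γ, (criticalExponent (stab Γ p) o).toReal ≤ κ := by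
  obtain ⟨D, hD0, hD⟩ := S.geometricallyFinite.exists_infDist_ray S.fourPoint S.regular S.cusps
    S.exists_limit_ne
  set F := {p | p ∈ parabolicPoints Γ ∧ (entryTime c p : ℝ) ≤ D + 1}
  have hF : F.Finite := S.finite_entryTime_le (D + 1)
  -- The entry point into H_p is within D + 1 of some g o, so the horoball at g⁻¹ • p is within D +
  -- 1 of `o`. The upper bound leaves finitely many such horoballs.
  have hrep : ∀ p ∈ parabolicPoints Γ, ∃ g ∈ Γ, ∃ q ∈ F, g • q = p := by
    intro p hp
    obtain ⟨γ, h0, rfl⟩ := exists_ray_from S.fourPoint S.regular o p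
    have h1 := hD γ h0 hp _ le_rfl
    rw [sub_self, sub_zero] at h1
    obtain ⟨_, ⟨g, hg, rfl⟩, hgd⟩ := (Metric.infDist_lt_iff (orbit_nonempty Γ o)).1
      ((le_abs_self _).trans_lt (h1.trans_lt (lt_add_one D)))
    have hq := smul_mem_parabolicPoints S.regular (Γ.inv_mem hg) hp
    refine ⟨g, hg, g⁻¹ • endpoint γ, ⟨hq, ?_⟩, smul_inv_smul g _⟩
    have h2 := S.cusps.depth_smul S.regular hg hq o
    rw [smul_inv_smul, depth_basepoint S.regular] at h2
    have h3 := depth_le_add_dist S.regular o c (endpoint γ)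
      (γ.1 (entryTime c (endpoint γ))) (g o)
    rw [depth_ray S.regular c h0, h2] at h3
    have h4 := neg_le_entryTime c (endpoint γ)
    rw [entryTime, Real.coe_toNNReal']
    exact max_le (by linarith) (by linarith)
  have hκ : ∀ p : Boundary X, ∃ κ < δ, p ∈ F → ∀ g ∈ Γ,
      (criticalExponent (stab Γ (g • p)) o).toReal ≤ κ := by
    intro p
    by_cases hp : p ∈ F
    · obtain ⟨κ, hκ, h⟩ := exists_criticalExponent_smul_le S.geometricallyFinite.discrete o
        (S.critical p hp.1)
      exact ⟨κ, hκ, fun _ => h⟩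
    · exact ⟨δ - 1, by linarith, fun h => absurd h hp⟩
  choose κ hκδ hκ using hκ
  obtain ⟨p₀, hp₀⟩ := S.nonempty
  obtain ⟨-, -, q₀, hq₀, -⟩ := hrep p₀ hp₀
  obtain ⟨q, hq, hmax⟩ := Set.exists_max_image F κ hF ⟨q₀, hq₀⟩
  refine ⟨κ q, hκδ q, fun p hp => ?_⟩
  obtain ⟨g, hg, r, hr, rfl⟩ := hrep p hp
  exact (hκ r hr g hg).trans (hmax r hr)

/-! ### Lower bound on the number of horoballs -/

/-- The limit points whose ray from `o` is at time `N` at distance at most `D` from the orbit. -/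
def recurrentSet (Γ : Subgroup (X ≃ᵢ X)) (o : X) (D : ℝ) (N : ℕ) : Set (Boundary X) :=
  {ξ | ∃ γ : GeodesicRay X, γ.1 0 = o ∧ endpoint γ = ξ ∧ ξ ∈ limitSet Γ ∧
    Metric.infDist (γ.1 N) (orbit Γ o) ≤ D}

/-- Limit points whose ray is at time `N` at depth `s` in a horoball lie in a small shadow. -/
theorem exists_mem_shadow_of_not_mem [ProperSpace X] (S : ShadowSystem Γ o δ α c H ν) :
    ∃ D : ℝ, ∀ s : ℝ, D ≤ s → ∀ N : ℕ, ∀ ξ ∈ limitSet Γ, ξ ∉ recurrentSet Γ o (s + D) N →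
      ∃ p ∈ parabolicPoints Γ, (entryTime c p : ℝ) + s ≤ N + D ∧
        ∀ γ : GeodesicRay X, γ.1 0 = o → endpoint γ = p → ∀ u : ℝ≥0,
          2 * (u : ℝ) + D ≤ N + entryTime c p + s → ξ ∈ shadow γ u := by
  obtain ⟨D, hD⟩ := S.geometricallyFinite.exists_infDist_le S.fourPoint S.regular S.cusps
    S.exists_limit_ne
  obtain ⟨b, hb0, hb⟩ := S.exists_level_le
  have hα := S.fourPoint.1
  refine ⟨max |D| (b + 24 * α + 2), fun s hs N ξ hξ hN => ?_⟩
  obtain ⟨γ, h0, rfl⟩ := exists_ray_from S.fourPoint S.regular o ξ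
  have hfar : s + max |D| (b + 24 * α + 2) < Metric.infDist (γ.1 N) (orbit Γ o) := by
    by_contra! hle
    exact hN ⟨γ, h0, rfl, hξ, hle⟩
  have hm1 := le_max_left |D| (b + 24 * α + 2)
  have hm2 := le_max_right |D| (b + 24 * α + 2)
  have hD' := le_abs_self D
  obtain ⟨p, hp, hdep⟩ : ∃ p ∈ parabolicPoints Γ, s ≤ depth o c p (γ.1 N) := by
    rcases hD _ (exists_gromovProduct_le_of_ray S.fourPoint S.regular h0 hξ N) with h | h
    · linarith
    · obtain ⟨p, hp, h⟩ := h
      exact ⟨p, hp, by linarith⟩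
  have h1 := boundaryProduct_le_dist S.regular o (γ.1 N) p
  have h2 := dist_ray_zero γ N
  have h3 := boundaryProduct_ray S.regular γ N
  rw [h0, NNReal.coe_natCast] at h2 h3
  have h4 : boundaryProduct o (γ.1 N) p = (N - busemann p (γ.1 N) o) / 2 := by
    rw [boundaryProduct, h2]
  -- Depth at least s gives (ξ_N | p)_o = (N − β_p(ξ_N, o))/2 ≥ (N + s + τ_p − b)/2, the time up to
  -- which the rays to ξ and p travel together. As this product is at most N, also τ_p + s ≤ N + b.
  have h5 := entryTime_le c p hb0 (hb p hp)
  rw [depth] at hdep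
  refine ⟨p, hp, by linarith, fun γ' h0' hγ' u hu => ?_⟩
  refine tube_subset_shadow (α := α) S.regular γ' (R := u + (12 * α + 1).toNNReal) ?_ ?_
  · rw [NNReal.coe_add, Real.coe_toNNReal _ (by linarith)]
    linarith
  · have hcoe : ((u + (12 * α + 1).toNNReal : ℝ≥0) : ℝ) = u + (12 * α + 1) := by
      rw [NNReal.coe_add, Real.coe_toNNReal _ (by linarith)]
    refine mem_tube_of_point S.fourPoint S.regular (w := γ.1 N) ?_ ?_
    · rw [h0', h3, hcoe]
      linarith
    · rw [h0', hγ', hcoe]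
      linarith

theorem sum_exp_neg_le {ε : ℝ} (hε : 0 < ε) (N : ℕ) :
    ∑ j ∈ Finset.range (N + 1), Real.exp (-ε * (N - j)) ≤ (1 - Real.exp (-ε))⁻¹ := by
  rw [← Finset.sum_range_reflect]
  have : ∀ j ∈ Finset.range (N + 1),
      Real.exp (-ε * (N - (N + 1 - 1 - j : ℕ))) = Real.exp (-ε) ^ j := by
    intro j hj
    rw [← Real.exp_nat_mul, Nat.add_sub_cancel, Nat.cast_sub (Finset.mem_range_succ_iff.1 hj)]
    ring_nf
  rw [Finset.sum_congr rfl this]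
  have h1 : Real.exp (-ε) < 1 := Real.exp_lt_one_iff.2 (by linarith)
  rw [← tsum_geometric_of_lt_one (Real.exp_pos _).le h1]
  exact (summable_geometric_of_lt_one (Real.exp_pos _).le h1).sum_le_tsum _
    fun i _ => pow_nonneg (Real.exp_pos _).le _

/-- The measure of the limit points which are deep in a horoball at time `N` is small. -/
theorem exists_le_recurrentSet [ProperSpace X] (S : ShadowSystem Γ o δ α c H ν) :
    ∃ D : ℝ, ∀ N : ℕ, ν.real Set.univ / 2 ≤ ν.real (recurrentSet Γ o D N) := by
  have := S.finite
  obtain ⟨C, hC, hsh⟩ := S.exists_shadow_bounds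
  obtain ⟨B, hB, hlayer⟩ := S.exists_ncard_layer_le
  obtain ⟨κ, hκδ, hκ⟩ := S.exists_criticalExponent_le
  obtain ⟨D, hD⟩ := S.exists_mem_shadow_of_not_mem
  choose γ h0 hγ using exists_ray_from S.fourPoint S.regular o
  have hδ := S.pos
  have hm : 0 < ν.real Set.univ := S.shadowLemma.univ_pos S.fourPoint S.regular S.nonempty
  set ε := δ - κ with hεdef
  have hε : 0 < ε := sub_pos.2 hκδ
  set A := B * C * (1 - Real.exp (-ε))⁻¹ with hA
  have hA0 : 0 < A := by
    have : Real.exp (-ε) < 1 := Real.exp_lt_one_iff.2 (by linarith)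
    have := sub_pos.2 this
    positivity
  -- The first condition places the shadows strictly after the entry times; the second makes the
  -- total mass of the deep limit points at most half.
  obtain ⟨s, hs1, hs2⟩ : ∃ s, 2 * |D| + 2 ≤ s ∧
      A * Real.exp (-ε * (s - D - 1)) ≤ ν.real Set.univ / 2 := by
    have hlim : Tendsto (fun s => A * Real.exp (-(ε * (s + (-D - 1))))) atTop (𝓝 0) := by
      rw [← mul_zero A]
      refine (Real.tendsto_exp_neg_atTop_nhds_zero.comp ?_).const_mul A
      exact (tendsto_atTop_add_const_right _ _ tendsto_id).const_mul_atTop hε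
    obtain ⟨s, h1, h2⟩ := ((eventually_ge_atTop (2 * |D| + 2)).and
      (hlim.eventually (gt_mem_nhds (half_pos hm)))).exists
    refine ⟨s, h1, le_trans (le_of_eq ?_) h2.le⟩
    ring_nf
  have hDa := le_abs_self D
  have hDn := neg_abs_le D
  refine ⟨s + D, fun N => ?_⟩
  set u : Boundary X → ℝ≥0 := fun p => ((N + entryTime c p + s - D) / 2 : ℝ).toNNReal with hu
  have huc : ∀ p, (u p : ℝ) = (N + entryTime c p + s - D) / 2 := fun p =>
    Real.coe_toNNReal _ (by have := (entryTime c p).2; have := N.cast_nonneg (α := ℝ); linarith)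
  have hcover : limitSet Γ ⊆ recurrentSet Γ o (s + D) N ∪
      ⋃ j ∈ Finset.range (N + 1), ⋃ p ∈ (S.finite_layer j).toFinset, shadow (γ p) (u p) := by
    intro ξ hξ
    by_cases hrec : ξ ∈ recurrentSet Γ o (s + D) N
    · exact Or.inl hrec
    right
    obtain ⟨p, hp, hpN, hps⟩ := hD s (by linarith [abs_nonneg D]) N ξ hξ hrec
    have hpN' : (entryTime c p : ℝ) ≤ N := by linarith [abs_nonneg D]
    simp only [Set.mem_iUnion]
    refine ⟨⌊(entryTime c p : ℝ)⌋₊, ?_, p, ?_, hps (γ p) (h0 p) (hγ p) (u p) ?_⟩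
    · rw [Finset.mem_range_succ_iff]
      exact Nat.floor_le_of_le hpN'
    · rw [Set.Finite.mem_toFinset]
      exact ⟨hp, Nat.floor_le (entryTime c p).2, (Nat.lt_floor_add_one _).le⟩
    · rw [huc]
      linarith
  -- Here 2(u p − τ_p) = N − τ_p + s − D, and the 1 comes from τ_p ≤ j + 1. The factor e^{−δj} will
  -- cancel the e^{δj} bounding the number of p in the layer.
  have hshadow : ∀ j ∈ Finset.range (N + 1), ∀ p ∈ (S.finite_layer j).toFinset,
      ν.real (shadow (γ p) (u p)) ≤
        C * Real.exp (-δ * j - ε * (N - j + (s - D - 1))) := by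
    intro j hj p hp
    have hjN : (j : ℝ) ≤ N := by exact_mod_cast Finset.mem_range_succ_iff.1 hj
    rw [Set.Finite.mem_toFinset] at hp
    obtain ⟨hp, hpj, hpj'⟩ := hp
    have h1 := (hsh (γ p) (h0 p) (by rwa [hγ]) (u p) (by
      rw [hγ, ← NNReal.coe_lt_coe, huc]
      linarith [abs_nonneg D]) _ rfl).2
    rw [hγ, huc] at h1
    refine h1.trans (mul_le_mul_of_nonneg_left (Real.exp_le_exp.2 ?_) hC.le)
    have h2 := hκ p hp
    set k := (criticalExponent (stab Γ p) o).toReal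
    have h3 : ε * (N - j + (s - D - 1)) ≤ (δ - k) * (N - entryTime c p + (s - D)) :=
      mul_le_mul (by linarith) (by linarith) (by linarith [abs_nonneg D]) (by linarith)
    have h4 := mul_le_mul_of_nonneg_left hpj hδ.le
    linarith
  have hsum : ν.real (⋃ j ∈ Finset.range (N + 1), ⋃ p ∈ (S.finite_layer j).toFinset,
      shadow (γ p) (u p)) ≤ ν.real Set.univ / 2 := by
    refine (measureReal_biUnion_finset_le _ _).trans (le_trans ?_ hs2)
    calc ∑ j ∈ Finset.range (N + 1), ν.real (⋃ p ∈ (S.finite_layer j).toFinset,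
          shadow (γ p) (u p))
        ≤ ∑ j ∈ Finset.range (N + 1),
            B * C * Real.exp (-ε * (s - D - 1)) * Real.exp (-ε * (N - j)) := by
          refine Finset.sum_le_sum fun j hj => (measureReal_biUnion_finset_le _ _).trans ?_
          refine (Finset.sum_le_card_nsmul _ _ _ (hshadow j hj)).trans ?_
          rw [nsmul_eq_mul, ← Set.ncard_eq_toFinset_card _ (S.finite_layer j)]
          refine (mul_le_mul_of_nonneg_right (hlayer j) (by positivity)).trans (le_of_eq ?_)
          rw [mul_mul_mul_comm, ← Real.exp_add, mul_assoc (B * C), ← Real.exp_add]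
          ring_nf
      _ = B * C * Real.exp (-ε * (s - D - 1)) *
            ∑ j ∈ Finset.range (N + 1), Real.exp (-ε * (N - j)) := by
          rw [Finset.mul_sum]
      _ ≤ B * C * Real.exp (-ε * (s - D - 1)) * (1 - Real.exp (-ε))⁻¹ :=
          mul_le_mul_of_nonneg_left (sum_exp_neg_le hε N) (by positivity)
      _ = A * Real.exp (-ε * (s - D - 1)) := by
          rw [hA]; ring
  have htot := measureReal_eq_univ_of_limitSet_subset S.support hcover
  have := measureReal_union_le (μ := ν) (recurrentSet Γ o (s + D) N)
    (⋃ j ∈ Finset.range (N + 1), ⋃ p ∈ (S.finite_layer j).toFinset, shadow (γ p) (u p))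
  linarith

/-- A recurrent limit point lies in the shadow of a parabolic point whose horoball is at distance
about `N` from `o`. -/
theorem exists_parabolic_of_mem_recurrentSet [ProperSpace X] (S : ShadowSystem Γ o δ α c H ν)
    (D : ℝ) : ∃ A : ℕ, ∀ N : ℕ, ∀ ξ ∈ recurrentSet Γ o D N, ∃ p ∈ parabolicPoints Γ,
      |-c p - N| ≤ A ∧ ∀ γ : GeodesicRay X, γ.1 0 = o → endpoint γ = p → ∀ u : ℝ≥0,
        (u : ℝ) + A ≤ N → ξ ∈ shadow γ u := by
  obtain ⟨p, hp⟩ := S.nonempty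
  obtain ⟨q, hq, hqp⟩ := S.exists_ne p hp
  obtain ⟨s, hs⟩ := exists_separated S.fourPoint S.regular o hqp
  have hα := S.fourPoint.1
  obtain ⟨A, hA⟩ := exists_nat_ge
    (2 * |D| + |c p| + |c q| + 2 * |s| + 12 * α + 4)
  refine ⟨A, fun N ξ hξ => ?_⟩
  obtain ⟨γ, h0, rfl, hξΛ, hN⟩ := hξ
  obtain ⟨_, ⟨g, hg, rfl⟩, hgd⟩ := (Metric.infDist_lt_iff (orbit_nonempty Γ o)).1
    (hN.trans_lt (lt_add_one D))
  have hD := le_abs_self D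
  have hs' := le_abs_self s
  have hs0 := abs_nonneg s
  have hD0 := abs_nonneg D
  -- Of the two fixed parabolic points, r is one whose translate g • r does not lie in the direction
  -- of `o` seen from g o. The ray from `o` to g • r then passes near g o, hence near γ N, and c (g
  -- • r) is −N up to a constant.
  obtain ⟨r, hr, hrc, hrs⟩ : ∃ r ∈ parabolicPoints Γ, |c r| ≤ |c p| + |c q| ∧
      boundaryProduct (g o) o (g • r) ≤ s := by
    have h1 : ∀ r, boundaryProduct (g o) o (g • r) = boundaryProduct o (g⁻¹ o) r := fun r => by
      have := boundaryProduct_smul S.regular g r o (g⁻¹ o)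
      rwa [IsometryEquiv.apply_inv_self] at this
    rcases min_le_iff.1 (hs (g⁻¹ o)) with h | h
    · exact ⟨q, hq, by linarith [abs_nonneg (c p)], (h1 q).trans_le h⟩
    · exact ⟨p, hp, by linarith [abs_nonneg (c q)], (h1 p).trans_le h⟩
  have h2 := dist_ray_zero γ N
  have h3 := boundaryProduct_ray S.regular γ N
  rw [h0, NNReal.coe_natCast] at h2 h3
  have h4 := dist_triangle (γ.1 N) (g o) o
  have h5 := dist_triangle_left (g o) o (γ.1 N)
  have h6 := boundaryProduct_add_swap S.regular o (g o) (g • r)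
  have h7 := boundaryProduct_le_add_dist S.regular o (g o) (γ.1 N) (g • r)
  rw [dist_comm (g o) (γ.1 N)] at h7
  have h8 := S.cusps.equivariant g hg r hr
  have h9 : boundaryProduct o (g o) (g • r) = (dist (g o) o - busemann (g • r) (g o) o) / 2 := rfl
  have h10 := boundaryProduct_nonneg S.regular (g o) o (g • r)
  obtain ⟨hc1, hc2⟩ := abs_le.1 hrc
  refine ⟨g • r, smul_mem_parabolicPoints S.regular hg hr, ?_, fun γ' h0' hγ' u hu => ?_⟩
  · rw [abs_le]
    constructor <;> linarith
  · have hcoe : ((u + (12 * α + 1).toNNReal : ℝ≥0) : ℝ) = u + (12 * α + 1) := by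
      rw [NNReal.coe_add, Real.coe_toNNReal _ (by linarith)]
    refine tube_subset_shadow (α := α) S.regular γ' (R := u + (12 * α + 1).toNNReal)
      (by rw [hcoe]; linarith) ?_
    have := abs_nonneg (c p)
    have := abs_nonneg (c q)
    refine mem_tube_of_point S.fourPoint S.regular (w := γ.1 N) ?_ ?_
    · rw [h0', h3, hcoe]
      linarith
    · rw [h0', hγ', hcoe]
      linarith

/-- The lower bound for the number of horoballs at distance about `N`. -/
theorem exists_le_ncard [ProperSpace X] (S : ShadowSystem Γ o δ α c H ν) :
    ∃ (A : ℕ) (B : ℝ), 0 < B ∧ ∀ N : ℕ, A ≤ N → B * Real.exp (δ * N) ≤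
      ({p | p ∈ parabolicPoints Γ ∧ |-c p - N| ≤ A}.ncard : ℝ) := by
  have := S.finite
  obtain ⟨D, hD⟩ := S.exists_le_recurrentSet
  obtain ⟨A, hA⟩ := S.exists_parabolic_of_mem_recurrentSet D
  obtain ⟨C, hC, hsh⟩ := S.shadowLemma.exists_le S.pos S.critical
  obtain ⟨E, hE0, hE⟩ := S.geometricallyFinite.exists_infDist_ray S.fourPoint S.regular S.cusps
    S.exists_limit_ne
  choose γ h0 hγ using exists_ray_from S.fourPoint S.regular o
  have hδ := S.pos
  have hm : 0 < ν.real Set.univ := S.shadowLemma.univ_pos S.fourPoint S.regular S.nonempty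
  -- The shadows are taken at time N − A, which costs δA. This time is within 2A of the entry time,
  -- where the distance to the orbit is at most E.
  set K := δ * A + δ * (E + 2 * A) with hK
  refine ⟨A, ν.real Set.univ / 2 / (C * Real.exp K), by positivity, fun N hN => ?_⟩
  have hN' : (A : ℝ) ≤ N := by exact_mod_cast hN
  have hA0 : (0 : ℝ) ≤ A := A.cast_nonneg
  set F := {p | p ∈ parabolicPoints Γ ∧ |-c p - N| ≤ A}
  -- A ≤ N ensures c p ≤ 0, so the truncation in `entryTime` has no effect.
  have hτ : ∀ p ∈ F, |(entryTime c p : ℝ) - N| ≤ A := by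
    rintro p ⟨-, hp⟩
    have h1 : 0 ≤ -c p := by linarith [(abs_le.1 hp).1]
    rwa [entryTime, Real.coe_toNNReal _ h1]
  have hF : F.Finite := (S.finite_entryTime_le (N + A)).subset fun p hp =>
    ⟨hp.1, by linarith [(abs_le.1 (hτ p hp)).2]⟩
  set u : ℝ≥0 := ((N - A : ℕ) : ℝ≥0)
  have hu : (u : ℝ) = N - A := by
    simp only [u, NNReal.coe_natCast]
    exact Nat.cast_sub hN
  have hcover : recurrentSet Γ o D N ⊆ ⋃ p ∈ hF.toFinset, shadow (γ p) u := by
    intro ξ hξ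
    obtain ⟨p, hp, hpN, hps⟩ := hA N ξ hξ
    rw [Set.mem_iUnion₂]
    exact ⟨p, hF.mem_toFinset.2 ⟨hp, hpN⟩, hps (γ p) (h0 p) (hγ p) u (by rw [hu]; linarith)⟩
  have hshadow : ∀ p ∈ hF.toFinset, ν.real (shadow (γ p) u) ≤
      C * Real.exp K * Real.exp (-δ * N) := by
    intro p hp
    rw [hF.mem_toFinset] at hp
    have h1 := hsh (γ p) (h0 p) (by rw [hγ]; exact hp.1.1) u
    have h2 := hE (γ p) (h0 p) (by rw [hγ]; exact hp.1) (entryTime c p) (by rw [hγ])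
    rw [hγ, sub_self, sub_zero] at h2
    have h3 := Metric.infDist_le_infDist_add_dist (s := orbit Γ o) (x := (γ p).1 u)
      (y := (γ p).1 (entryTime c p))
    rw [dist_ray, hu] at h3
    have h4 : |(N - A : ℝ) - entryTime c p| ≤ 2 * A := by
      have := abs_le.1 (hτ p hp)
      rw [abs_le]; constructor <;> linarith
    have h5 := le_abs_self (Metric.infDist ((γ p).1 (entryTime c p)) (orbit Γ o))
    refine h1.trans ?_
    rw [mul_assoc, ← Real.exp_add]
    refine mul_le_mul_of_nonneg_left (Real.exp_le_exp.2 ?_) hC.le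
    have h6 : δ * Metric.infDist ((γ p).1 u) (orbit Γ o) ≤ δ * (E + 2 * A) :=
      mul_le_mul_of_nonneg_left (by linarith) hδ.le
    rw [hu, hK]
    linarith
  have h1 := (hD N).trans ((measureReal_mono hcover (measure_ne_top ν _)).trans
    ((measureReal_biUnion_finset_le _ _).trans (Finset.sum_le_card_nsmul _ _ _ hshadow)))
  rw [nsmul_eq_mul, ← Set.ncard_eq_toFinset_card _ hF, neg_mul, Real.exp_neg] at h1
  rw [div_mul_eq_mul_div, div_le_iff₀ (by positivity)]
  have h2 := mul_le_mul_of_nonneg_right h1 (Real.exp_pos (δ * N)).le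
  refine h2.trans (le_of_eq ?_)
  field_simp

/-! ### From levels to radii -/

theorem radius_eq [ProperSpace X] (S : ShadowSystem Γ o δ α c H ν) {p : Boundary X}
    (hp : p ∈ parabolicPoints Γ) (h : c p ≤ 0) : radius o (H p) = Real.exp (c p) := by
  have hmem : ∀ y, y ∈ H p ↔ busemann p y o < c p := fun y => by
    rw [S.level p hp, Set.mem_ofPred_eq]
  obtain ⟨γ, h0, rfl⟩ := exists_ray_from S.fourPoint S.regular o p
  have hray : ∀ t : ℝ≥0, -c (endpoint γ) < t → γ.1 t ∈ H (endpoint γ) := fun t ht => by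
    have := depth_ray S.regular c h0 t
    rw [depth] at this
    rw [hmem]
    linarith
  have h1 : Metric.infDist o (H (endpoint γ))ᶜ = 0 := by
    refine Metric.infDist_zero_of_mem ?_
    rw [Set.mem_compl_iff, hmem, busemann_self S.regular]
    exact not_lt.2 h
  have h2 : Metric.infDist o (H (endpoint γ)) = -c (endpoint γ) := by
    refine le_antisymm (le_of_forall_pos_le_add fun ε hε => ?_) ?_
    · have hcoe : (((-c (endpoint γ) + ε).toNNReal : ℝ≥0) : ℝ) = -c (endpoint γ) + ε :=
        Real.coe_toNNReal _ (by linarith)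
      have h3 := Metric.infDist_le_dist_of_mem (x := o)
        (hray (-c (endpoint γ) + ε).toNNReal (by linarith))
      have h4 := dist_ray_zero γ (-c (endpoint γ) + ε).toNNReal
      rw [h0, dist_comm, hcoe] at h4
      linarith
    · rw [Metric.le_infDist ⟨_, hray (-c (endpoint γ) + 1).toNNReal (by
        rw [Real.coe_toNNReal _ (by linarith)]; linarith)⟩]
      intro y hy
      rw [hmem] at hy
      have := neg_dist_le_busemann S.regular (endpoint γ) y o
      rw [dist_comm]
      linarith
  rw [radius, h1, h2, sub_zero, neg_neg]

/-- When `o` lies inside H_p this inequality suffices: such a p can only belong to the band n = 0.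
-/
theorem one_le_radius (S : ShadowSystem Γ o δ α c H ν) {p : Boundary X}
    (hp : p ∈ parabolicPoints Γ) (h : 0 < c p) : 1 ≤ radius o (H p) := by
  have hmem : o ∈ H p := by
    rw [S.level p hp, Set.mem_ofPred_eq, busemann_self S.regular]
    exact h
  rw [radius, Metric.infDist_zero_of_mem hmem, Real.one_le_exp_iff]
  simpa using Metric.infDist_nonneg

theorem exp_neg_nat_pow (L n : ℕ) : Real.exp (-L : ℝ) ^ n = Real.exp (-(n * L : ℝ)) := by
  rw [← Real.exp_nat_mul]
  ring_nf

/-- The bands in terms of the levels of the horoballs. -/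
theorem mem_horoballBand_iff [ProperSpace X] (S : ShadowSystem Γ o δ α c H ν) {L n : ℕ}
    {p : Boundary X} (hp : p ∈ parabolicPoints Γ) (h : c p ≤ 0) :
    p ∈ horoballBand Γ o H (Real.exp (-L)) n ↔
      (n * L : ℝ) ≤ -c p ∧ -c p ≤ (n + 1) * L := by
  rw [horoballBand, Set.mem_ofPred_eq, S.radius_eq hp h, exp_neg_nat_pow, exp_neg_nat_pow,
    Real.exp_le_exp, Real.exp_le_exp]
  push_cast
  constructor
  · rintro ⟨-, h1, h2⟩
    constructor <;> linarith
  · rintro ⟨h1, h2⟩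
    exact ⟨hp, by linarith, by linarith⟩

theorem horoballBand_subset [ProperSpace X] (S : ShadowSystem Γ o δ α c H ν) {L : ℕ}
    (hL : 0 < L) (n : ℕ) : horoballBand Γ o H (Real.exp (-L)) n ⊆
      ⋃ i ∈ Finset.range (L + 1), layer Γ c (n * L + i) := by
  intro p hp
  have hpP := hp.1
  have key : (n * L : ℝ) ≤ entryTime c p ∧ (entryTime c p : ℝ) ≤ (n + 1) * L := by
    rw [entryTime, Real.coe_toNNReal']
    rcases le_or_gt (c p) 0 with h | h
    · rw [max_eq_left (by linarith)]
      exact (S.mem_horoballBand_iff hpP h).1 hp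
    · have h1 := (S.one_le_radius hpP h).trans hp.2.2
      rw [exp_neg_nat_pow, Real.one_le_exp_iff] at h1
      rw [max_eq_right (by linarith)]
      exact ⟨by linarith, by positivity⟩
  rw [Set.mem_iUnion₂]
  have hfl : n * L ≤ ⌊(entryTime c p : ℝ)⌋₊ := Nat.le_floor (by push_cast; exact key.1)
  refine ⟨⌊(entryTime c p : ℝ)⌋₊ - n * L, ?_, ?_⟩
  · rw [Finset.mem_range_succ_iff, Nat.sub_le_iff_le_add]
    refine Nat.floor_le_of_le ?_
    push_cast
    linarith [key.2]
  · rw [Nat.add_sub_cancel' hfl]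
    exact ⟨hpP, Nat.floor_le (entryTime c p).2, (Nat.lt_floor_add_one _).le⟩

/-- Horoball counting. -/
theorem exists_horoballBand_bounds [ProperSpace X] (S : ShadowSystem Γ o δ α c H ν) :
    ∃ l : ℝ, 0 < l ∧ l < 1 ∧ ∃ C : ℝ, 0 < C ∧ ∀ n : ℕ,
      (horoballBand Γ o H l n).Finite ∧
      C⁻¹ * l ^ (-(n * δ)) ≤ ((horoballBand Γ o H l n).ncard : ℝ) ∧
      ((horoballBand Γ o H l n).ncard : ℝ) ≤ C * l ^ (-(n * δ)) := by
  obtain ⟨A, B, hB, hlow⟩ := S.exists_le_ncard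
  obtain ⟨C, hC, hup⟩ := S.exists_ncard_layer_le
  have hδ := S.pos
  -- Band n consists, when c p ≤ 0, of the levels −c p in [nL, (n + 1)L]. With L > 2A it contains
  -- the window of radius A around nL + A used for the lower bound.
  set L := 2 * A + 1 with hL
  set M := max B⁻¹ ((L + 1) * C * Real.exp (δ * L)) with hM
  refine ⟨Real.exp (-L), Real.exp_pos _, Real.exp_lt_one_iff.2 (by
    rw [hL]; push_cast; linarith [A.cast_nonneg (α := ℝ)]), M,
    (inv_pos.2 hB).trans_le (le_max_left _ _), fun n => ?_⟩
  have hfin : (⋃ i ∈ Finset.range (L + 1), layer Γ c (n * L + i)).Finite :=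
    (Finset.range (L + 1)).finite_toSet.biUnion fun i _ => S.finite_layer _
  have hsub := S.horoballBand_subset (L := L) (by omega) n
  have hpow : Real.exp (-L : ℝ) ^ (-(n * δ)) = Real.exp (δ * (n * L)) := by
    rw [← Real.exp_mul]
    ring_nf
  rw [hpow]
  refine ⟨hfin.subset hsub, ?_, ?_⟩
  · have h1 := hlow (n * L + A) (by omega)
    have h2 : {p | p ∈ parabolicPoints Γ ∧ |-c p - (n * L + A : ℕ)| ≤ A} ⊆
        horoballBand Γ o H (Real.exp (-L)) n := by
      rintro p ⟨hp, hpA⟩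
      rw [abs_le] at hpA
      push_cast at hpA
      have hL' : (L : ℝ) = 2 * A + 1 := by rw [hL]; push_cast; ring
      have h3 : (0 : ℝ) ≤ n * L := by positivity
      rw [S.mem_horoballBand_iff hp (by linarith)]
      constructor <;> linarith
    have h3 := Set.ncard_le_ncard h2 (hfin.subset hsub)
    have h4 : M⁻¹ ≤ B := inv_le_of_inv_le₀ hB (le_max_left _ _)
    calc M⁻¹ * Real.exp (δ * (n * L)) ≤ B * Real.exp (δ * ((n * L + A : ℕ) : ℝ)) := by
          refine mul_le_mul h4 (Real.exp_le_exp.2 (mul_le_mul_of_nonneg_left ?_ hδ.le))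
            (Real.exp_pos _).le hB.le
          push_cast
          linarith [A.cast_nonneg (α := ℝ)]
      _ ≤ _ := h1
      _ ≤ _ := by exact_mod_cast h3
  · have h1 : (horoballBand Γ o H (Real.exp (-L)) n).ncard ≤
        ∑ i ∈ Finset.range (L + 1), (layer Γ c (n * L + i)).ncard :=
      (Set.ncard_le_ncard hsub hfin).trans (Finset.set_ncard_biUnion_le _ _)
    have h2 : ∀ i ∈ Finset.range (L + 1), ((layer Γ c (n * L + i)).ncard : ℝ) ≤
        C * Real.exp (δ * L) * Real.exp (δ * (n * L)) := by
      intro i hi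
      refine (hup _).trans ?_
      rw [mul_assoc, ← Real.exp_add]
      refine mul_le_mul_of_nonneg_left (Real.exp_le_exp.2 ?_) hC.le
      rw [← mul_add]
      refine mul_le_mul_of_nonneg_left ?_ hδ.le
      have : (i : ℝ) ≤ L := by exact_mod_cast Finset.mem_range_succ_iff.1 hi
      push_cast
      linarith
    have h3 : ((horoballBand Γ o H (Real.exp (-L)) n).ncard : ℝ) ≤
        ∑ i ∈ Finset.range (L + 1), ((layer Γ c (n * L + i)).ncard : ℝ) := by exact_mod_cast h1
    refine h3.trans ((Finset.sum_le_card_nsmul _ _ _ h2).trans ?_)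
    rw [nsmul_eq_mul, Finset.card_range, ← mul_assoc]
    refine mul_le_mul_of_nonneg_right (le_trans (le_of_eq ?_) (le_max_right _ _))
      (Real.exp_pos _).le
    push_cast
    ring

end ShadowSystem
end GromovHyp
end

open GromovHyp
theorem propositionP {X : Type*} [MetricSpace X] [ProperSpace X]
    (hX : IsBusemannRegularHyperbolic X)
    (Γ : Subgroup (X ≃ᵢ X)) (hΓ : IsGeometricallyFinite Γ)
    (hP : (parabolicPoints Γ).Nonempty)
    (o : X) (H : Boundary X → Set X) (hH : IsHoroballPacking Γ H)
    (δ : ℝ) (μ : X → MeasureTheory.Measure (Boundary X)) (hμ : IsConformalDensity Γ δ μ)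
    (hδ : ∀ p ∈ parabolicPoints Γ, criticalExponent (stab Γ p) o < (δ : EReal))
    (hshadow : GlobalShadowLemma Γ o H δ (μ o)) :
    ∃ l : ℝ, 0 < l ∧ l < 1 ∧ ∃ C : ℝ, 0 < C ∧ ∀ n : ℕ,
      (horoballBand Γ o H l n).Finite ∧
      C⁻¹ * l ^ (-(n * δ)) ≤ ((horoballBand Γ o H l n).ncard : ℝ) ∧
      ((horoballBand Γ o H l n).ncard : ℝ) ≤ C * l ^ (-(n * δ)) := by
  obtain ⟨α, hα⟩ : ∃ α, FourPoint X α := hX.hyperbolic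
  have := hμ.finite o
  have hne : ∀ p ∈ parabolicPoints Γ, ∃ q ∈ parabolicPoints Γ, q ≠ p := fun p hp =>
    hshadow.exists_parabolic_ne hα hX (hμ.support o) hμ.dim_pos hδ hp
  obtain ⟨c, hc, hlevel⟩ := exists_cuspFamily (o := o) hα hX hH hne
  exact ShadowSystem.exists_horoballBand_bounds
    { regular := hX, fourPoint := hα, geometricallyFinite := hΓ, cusps := hc, level := hlevel,
      nonempty := hP, exists_ne := hne, pos := hμ.dim_pos, critical := hδ,
      finite := hμ.finite o, support := hμ.support o, shadowLemma := hshadow }
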